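/- Let $\mathcal{E}$ and $\mathcal{E}_c$ be two ellipses (circles allowed) in the Euclidean plane, with $\mathcal{E}_c$ contained in the open region bounded by $\mathcal{E}$. Let $\mathcal{T}$ be the Poncelet family of all nondegenerate triangles $ABC$ that are inscribed in $\mathcal{E}$ and whose side lines are tangent to $\mathcal{E}_c$. Let $\mathcal{R}$ be the region swept by the circumcircle (the curve) over the family, i.e. the union of the circumcircles of all triangles in $\mathcal{T}$, and let $\partial\mathcal{R}$ be its topological boundary. For a point $P$, let $\mathcal{L}^{\dagger}$ be the locus of the isogonal conjugate of $P$ over $\mathcal{T}$, i.e. the set of all points $Q$ that are the isogonal conjugate of $P$ with respect to some triangle $ABC\in\mathcal{T}$: $P$ is not a vertex, and $Q$ lies on each of the three lines obtained by reflecting $AP$, $BP$, $CP$ in the bisectors of the angles of the triangle at $A$, $B$, $C$ respectively. (There is no such finite point $Q$ when $P$ lies on the circumcircle of $ABC$.) If $P\in\partial\mathcal{R}$ and $P\notin\mathcal{E}$, then $\mathcal{L}^{\dagger}$ is a parabola, i.e. there are a line $d$ and a point $F\notin d$ such that $\mathcal{L}^{\dagger}$ is exactly the set of points whose distance to $F$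 equals their distance to $d$. -/

import Mathlib

open EuclideanGeometry

noncomputable section

namespace PonceletIsogonal

/-- The ellipse determined by an affine bijection `φ` of the Euclidean plane `ℂ`:
the image of the unit circle. Every ellipse (circles included) has this form. -/
def ellipse (φ : ℂ ≃ᵃ[ℝ] ℂ) : Set ℂ :=
  φ '' Metric.sphere 0 1

/-- The open region bounded by `ellipse φ`. -/
def ellipseInterior (φ : ℂ ≃ᵃ[ℝ] ℂ) : Set ℂ :=
  φ '' Metric.ball 0 1

/-- The line through the points `X`, `Y` is tangent to the ellipse `S`: they have exactly one
common point. -/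
def IsTangentLine (S : Set ℂ) (X Y : ℂ) : Prop :=
  ∃! Z : ℂ, Z ∈ line[ℝ, X, Y] ∧ Z ∈ S

/-- `A B C` is a nondegenerate triangle inscribed in `E` whose sides are tangent to `Ec`, that is,
a member of the Poncelet family interscribed between `E` and `Ec`. -/
structure IsPonceletTriangle (E Ec : Set ℂ) (A B C : ℂ) : Prop where
  nondegenerate : AffineIndependent ℝ ![A, B, C]
  mem_A : A ∈ E
  mem_B : B ∈ E
  mem_C : C ∈ E
  tangent_BC : IsTangentLine Ec B C
  tangent_CA : IsTangentLine Ec C A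
  tangent_AB : IsTangentLine Ec A B

/-- The circle through the vertices of the triangle `A B C`. -/
def circumcircle (A B C : ℂ) : Set ℂ :=
  {X | Cospherical ({A, B, C, X} : Set ℂ)}

/-- The region swept by the circumcircle (the curve, not the disk) over the Poncelet family. -/
def sweptRegion (E Ec : Set ℂ) : Set ℂ :=
  {X | ∃ A B C : ℂ, IsPonceletTriangle E Ec A B C ∧ X ∈ circumcircle A B C}

/-- The bisector of the angle `B A C` of the triangle `A B C`, as a line through `A`. -/
def angleBisector (A B C : ℂ) : AffineSubspace ℝ ℂ :=
  line[ℝ, A, A + (‖B - A‖⁻¹ • (B - A) + ‖C - A‖⁻¹ • (C - A))]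

instance (A B C : ℂ) : Nonempty (angleBisector A B C) :=
  ⟨⟨A, left_mem_affineSpan_pair ℝ _ _⟩⟩

/-- The line `A P` reflected in the bisector of the angle `B A C`. -/
def reflectedCevian (A B C P : ℂ) : Set ℂ :=
  reflection (angleBisector A B C) '' (line[ℝ, A, P] : Set ℂ)

/-- `Q` is the isogonal conjugate of `P` with respect to the triangle `A B C`: the point common
to the three reflected cevians of `P`. If `P` is on the circumcircle there is no such point; if
`P` is on a side line (and not a vertex), it is the opposite vertex. -/
structure IsIsogonalConjugate (A B C P Q : ℂ) : Prop where
  ne_A : P ≠ A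
  ne_B : P ≠ B
  ne_C : P ≠ C
  mem_A : Q ∈ reflectedCevian A B C P
  mem_B : Q ∈ reflectedCevian B C A P
  mem_C : Q ∈ reflectedCevian C A B P

/-- The locus of the isogonal conjugate of the fixed point `P` over the Poncelet family. -/
def isogonalLocus (E Ec : Set ℂ) (P : ℂ) : Set ℂ :=
  {Q | ∃ A B C : ℂ, IsPonceletTriangle E Ec A B C ∧ IsIsogonalConjugate A B C P Q}

/-- `S` is a (nondegenerate, complete) parabola: the set of all points equidistant from a focus
`F` and a directrix `D₁ D₂` not through `F`. -/
def IsParabola (S : Set ℂ) : Prop :=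
  ∃ F D₁ D₂ : ℂ, D₁ ≠ D₂ ∧ F ∉ line[ℝ, D₁, D₂] ∧
    S = {X | dist X F = Metric.infDist X (line[ℝ, D₁, D₂] : Set ℂ)}

end PonceletIsogonal

end

/-! Pull the outer ellipse back to the unit circle by `φ`. The inner ellipse becomes an ellipse in
the open unit disc, with foci `f`, `g`; put `s = f + g`, `h = f g`. Once one Poncelet triangle
exists, the vertex triples are exactly the solution sets of `z (z - f)(z - g) = l (1 - f̄ z)(1 - ḡ
z)`, where `l = z₁ z₂ z₃` runs over the whole unit circle (`exists_isPonceletTriangle_iff`). The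
other elementary symmetric functions of the vertices are then affine in `l`.

The original metric is restored by writing `φ z = a + p z + q z̄`. For fixed `P = φ Z`, the power of
`P` with respect to the circumcircle is a real trigonometric polynomial `k + 2 Re (L l)`. The
isogonal conjugate of `P` is `P + N(l) / power(l)` with `N(l) = n₁ l + n₀ + n₂ l̄`
(`IsBlaschkeTriple.isIsogonalConjugate_iff`). The swept region is therefore `k² ≤ 4 |L|²`, and on
its boundary the power has a double zero at a single unit number `l₀`.

The substitution `l = l₀ (x + i)/(x - i)` sends `l₀` to infinity and cancels the denominator, so the
locus is the full range of a quadratic polynomial in the real variable `x` (`image_unit_eq_range`).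
Such a range is a parabola as soon as the coefficients of `x` and `x²` are independent over `ℝ`
(`isParabola_range`). Independence follows from a determinant which factors (`isogonal_det`). Off
the outer ellipse it can vanish only if `P` is a focus of the inner ellipse. A focus would have the
other focus as constant conjugate, so `N` would vanish together with the power at `l₀`, which
`IsBlaschkeTriple.isogonalNum_ne_zero` excludes. -/

namespace PonceletIsogonal

open Complex ComplexConjugate

/-! ### Affine maps, trigonometric polynomials and lines in complex coordinates -/

/-- Every affine bijection of the complex plane is `z ↦ a + p z + q z̄` with `|p| ≠ |q|`. -/
theorem exists_affineEquiv_eq (φ : ℂ ≃ᵃ[ℝ] ℂ) :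
    ∃ a p q : ℂ, (∀ z, φ z = a + p * z + q * conj z) ∧ p * conj p - q * conj q ≠ 0 := by
  set L := φ.linear with hL
  have hφ : ∀ z, φ z = φ 0 + L z := by
    intro z
    have := φ.map_vadd 0 z
    simp only [vadd_eq_add, add_zero] at this
    rw [this, add_comm]
  set p : ℂ := (L 1 - I * L I) / 2 with hp
  set q : ℂ := (L 1 + I * L I) / 2 with hq
  have hLz : ∀ z, L z = p * z + q * conj z := by
    intro z
    have h1 : z = z.re • (1 : ℂ) + z.im • I := by
      apply Complex.ext <;> simp
    have h2 : L z = z.re • L 1 + z.im • L I := by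
      conv_lhs => rw [h1]
      rw [map_add, map_smul, map_smul]
    have h4 : conj z = z.re - z.im * I := by
      apply Complex.ext <;> simp
    have h3 : p * z + q * conj z = p * (z.re + z.im * I) + q * (z.re - z.im * I) := by
      rw [h4, re_add_im]
    rw [h2, h3, real_smul, real_smul, hp, hq]
    linear_combination ((z.im : ℂ) * L I) * I_mul_I
  refine ⟨φ 0, p, q, fun z => by rw [hφ, hLz]; ring, ?_⟩
  intro h
  have key : ∀ z, L z = 0 → z = 0 := fun z hz => by simpa using hz
  -- When `|p| = |q|` the linear part kills both `p̄ - q` and `i (p̄ + q)`; injectivity then forces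
  -- `p = q = 0`.
  have e1 := key (conj p - q) (by rw [hLz]; simp; linear_combination h)
  have e2 := key (conj p * I + q * I) (by rw [hLz]; simp; linear_combination I * h)
  have hq0 : q = 0 := by
    have : (2 * I) * q = 0 := by linear_combination e2 - I * e1
    simpa using this
  have hp0 : p = 0 := by
    have : conj p = 0 := by linear_combination e1 + hq0
    simpa using this
  have : (1 : ℂ) = 0 := key 1 (by rw [hLz, hp0, hq0]; simp)
  exact one_ne_zero this

theorem conj_eq_of_mul_conj {z : ℂ} (h : z * conj z = 1) : conj z = z⁻¹ :=
  eq_inv_of_mul_eq_one_right h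

theorem norm_eq_one_iff_mul_conj {z : ℂ} : ‖z‖ = 1 ↔ z * conj z = 1 := by
  rw [mul_conj, normSq_eq_norm_sq]
  constructor
  · intro h; simp [h]
  · intro h
    have : ‖z‖ ^ 2 = 1 := by exact_mod_cast h
    nlinarith [norm_nonneg z]

/-- A real trigonometric polynomial `d + 2 Re (L u)` has a zero on the unit circle
iff `d² ≤ 4 |L|²`. -/
theorem exists_unit_add_two_re_eq_zero_iff {d : ℝ} {L : ℂ} :
    (∃ u : ℂ, ‖u‖ = 1 ∧ d + 2 * (L * u).re = 0) ↔ d ^ 2 ≤ 4 * ‖L‖ ^ 2 := by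
  constructor
  · rintro ⟨u, hu, h⟩
    have h1 : |(L * u).re| ≤ ‖L‖ := by
      have := abs_re_le_norm (L * u)
      rwa [norm_mul, hu, mul_one] at this
    have h2 := sq_le_sq' (abs_le.1 h1).1 (abs_le.1 h1).2
    have h3 : d = -2 * (L * u).re := by linarith
    rw [h3]; nlinarith
  · intro h
    by_cases hL : L = 0
    · refine ⟨1, by simp, ?_⟩
      have : d = 0 := by
        rw [hL] at h; simp at h; nlinarith [sq_nonneg d]
      simp [hL, this]
    · have hn : 0 < ‖L‖ := norm_pos_iff.2 hL
      set y := Real.sqrt (‖L‖ ^ 2 - (d / 2) ^ 2) with hy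
      have hy2 : y ^ 2 = ‖L‖ ^ 2 - (d / 2) ^ 2 := Real.sq_sqrt (by nlinarith)
      refine ⟨(⟨-d / 2, y⟩ : ℂ) / L, ?_, ?_⟩
      · rw [norm_div, div_eq_one_iff_eq hn.ne']
        have : ‖(⟨-d / 2, y⟩ : ℂ)‖ ^ 2 = ‖L‖ ^ 2 := by
          rw [← normSq_eq_norm_sq, normSq_mk]; nlinarith
        exact (pow_left_inj₀ (norm_nonneg _) hn.le two_ne_zero).1 this
      · rw [mul_div_cancel₀ _ hL]; simp; ring

theorem existsUnique_unit_add_two_re_eq_zero_iff {d : ℝ} {L : ℂ} (hL : L ≠ 0) :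
    (∃! u : ℂ, ‖u‖ = 1 ∧ d + 2 * (L * u).re = 0) ↔ d ^ 2 = 4 * ‖L‖ ^ 2 := by
  constructor
  · rintro ⟨u, ⟨hu, h⟩, huniq⟩
    -- Conjugating `L u` preserves both its modulus and its real part, so it gives a second
    -- solution; uniqueness forces `L u` to be real.
    have hv := huniq (conj (L * u) / L) ⟨by
      rw [norm_div, norm_conj, norm_mul, hu, mul_one, div_self (norm_ne_zero_iff.2 hL)], by
      rw [mul_div_cancel₀ _ hL, conj_re]; exact h⟩
    have h2 : conj (L * u) = L * u := by
      rw [div_eq_iff hL] at hv; rw [hv, mul_comm]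
    have h3 : (L * u).im = 0 := conj_eq_iff_im.1 h2
    have h4 : ‖L‖ ^ 2 = (L * u).re ^ 2 + (L * u).im ^ 2 := by
      rw [← mul_one ‖L‖, ← hu, ← norm_mul, ← normSq_eq_norm_sq, normSq_apply]; ring
    rw [h3] at h4
    have h5 : d = -2 * (L * u).re := by linarith
    rw [h4, h5]; ring
  · intro h
    obtain ⟨u, hu, h0⟩ := exists_unit_add_two_re_eq_zero_iff.2 h.le
    have key : ∀ v : ℂ, ‖v‖ = 1 ∧ d + 2 * (L * v).re = 0 → L * v = ((-d / 2 : ℝ) : ℂ) := by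
      rintro v ⟨hv, hv0⟩
      have h4 : ‖L‖ ^ 2 = (L * v).re ^ 2 + (L * v).im ^ 2 := by
        rw [← mul_one ‖L‖, ← hv, ← norm_mul, ← normSq_eq_norm_sq, normSq_apply]; ring
      have hre : (L * v).re = -d / 2 := by linarith
      have him : (L * v).im ^ 2 = 0 := by rw [hre] at h4; nlinarith
      apply Complex.ext
      · rw [ofReal_re, hre]
      · rw [ofReal_im]; exact pow_eq_zero_iff two_ne_zero |>.1 him
    refine ⟨u, ⟨hu, h0⟩, fun v hv => mul_left_cancel₀ hL ?_⟩
    rw [key v hv, key u ⟨hu, h0⟩]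

theorem mem_line_iff {A B X : ℂ} : X ∈ line[ℝ, A, B] ↔ ∃ r : ℝ, X = A + r * (B - A) := by
  rw [mem_affineSpan_pair_iff_exists_lineMap_eq]
  constructor
  · rintro ⟨r, rfl⟩
    exact ⟨r, by simp [AffineMap.lineMap_apply, add_comm]⟩
  · rintro ⟨r, rfl⟩
    exact ⟨r, by simp [AffineMap.lineMap_apply, add_comm]⟩

theorem map_mem_line_iff (φ : ℂ ≃ᵃ[ℝ] ℂ) {A B X : ℂ} :
    φ X ∈ line[ℝ, φ A, φ B] ↔ X ∈ line[ℝ, A, B] := by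
  rw [mem_affineSpan_pair_iff_exists_lineMap_eq,
    mem_affineSpan_pair_iff_exists_lineMap_eq]
  refine exists_congr fun r => ?_
  rw [← AffineEquiv.coe_toAffineMap, ← AffineMap.apply_lineMap, AffineEquiv.coe_toAffineMap]
  exact φ.injective.eq_iff

/-! ### Tangent chords and the foci of the inner ellipse -/

/-- The chord of the unit circle through `z₁`, `z₂`. -/
theorem mem_chord_iff {z₁ z₂ x : ℂ} (h₁ : z₁ * conj z₁ = 1) (h₂ : z₂ * conj z₂ = 1)
    (h : z₁ ≠ z₂) : x ∈ line[ℝ, z₁, z₂] ↔ x + z₁ * z₂ * conj x = z₁ + z₂ := by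
  have hsub : z₂ - z₁ ≠ 0 := sub_ne_zero.2 h.symm
  rw [mem_line_iff]
  constructor
  · rintro ⟨r, rfl⟩
    simp only [map_add, map_mul, map_sub, conj_ofReal]
    linear_combination (z₂ - r * z₂) * h₁ + r * z₁ * h₂
  · intro hx
    have hreal : conj ((x - z₁) / (z₂ - z₁)) = (x - z₁) / (z₂ - z₁) := by
      have hsub' : conj z₂ - conj z₁ ≠ 0 := by
        rw [← map_sub]; exact (map_ne_zero _).2 hsub
      have hz1 : z₁ ≠ 0 := left_ne_zero_of_mul_eq_one h₁
      have hz2 : z₂ ≠ 0 := left_ne_zero_of_mul_eq_one h₂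
      simp only [map_div₀, map_sub]
      rw [div_eq_div_iff hsub' hsub]
      apply mul_left_cancel₀ (mul_ne_zero hz1 hz2)
      linear_combination (z₂ - z₁) * hx + (z₂*x-z₂*z₂)*h₁ + (z₁*z₁ - z₁ * x) * h₂
    obtain ⟨r, hr⟩ := conj_eq_iff_real.1 hreal
    refine ⟨r, ?_⟩
    rw [← hr, div_mul_cancel₀ _ hsub]; ring

/-- Tangency of a chord of the unit circle to the ellipse `u ↦ c + p u + q ū`. -/
theorem existsUnique_chord_inter_iff {c p q z₁ z₂ : ℂ} (hpq : p * conj p - q * conj q ≠ 0)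
    (h₁ : z₁ * conj z₁ = 1) (h₂ : z₂ * conj z₂ = 1) :
    (∃! u : ℂ, ‖u‖ = 1 ∧ (c + p * u + q * conj u) + z₁ * z₂ * conj (c + p * u + q * conj u)
      = z₁ + z₂) ↔
    (c + z₁ * z₂ * conj c - z₁ - z₂) ^ 2
      = 4 * (p + z₁ * z₂ * conj q) * (q + z₁ * z₂ * conj p) := by
  -- Dividing the chord equation by a square root `n` of `z₁ z₂` makes it real, of the form `d + 2
  -- Re (L u) = 0`; tangency then means a double zero, `d² = 4 |L|²`.
  obtain ⟨n, hn⟩ : ∃ n : ℂ, n ^ 2 = z₁ * z₂ := IsAlgClosed.exists_pow_nat_eq _ two_pos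
  have hnn : n * conj n = 1 := by
    rw [← norm_eq_one_iff_mul_conj]
    have h1 : ‖n‖ ^ 2 = 1 := by
      rw [← norm_pow, hn, norm_mul, norm_eq_one_iff_mul_conj.2 h₁, norm_eq_one_iff_mul_conj.2 h₂,
        one_mul]
    nlinarith [norm_nonneg n]
  have hn0 : n ≠ 0 := left_ne_zero_of_mul_eq_one hnn
  set L : ℂ := conj n * p + n * conj q with hL
  have hd : conj (conj n * c + n * conj c - n * (conj z₁ + conj z₂))
      = conj n * c + n * conj c - n * (conj z₁ + conj z₂) := by
    simp only [map_add, map_sub, map_mul, conj_conj]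
    have : conj n * (z₁ + z₂) = n * (conj z₁ + conj z₂) := by
      apply mul_left_cancel₀ hn0
      linear_combination (z₁ + z₂) * hnn - z₁ * h₂ - z₂ * h₁ - (conj z₁ + conj z₂) * hn
    linear_combination -this
  obtain ⟨d, hd'⟩ := conj_eq_iff_real.1 hd
  have hL0 : L ≠ 0 := by
    intro h0
    apply hpq
    have h0' : conj L = 0 := by rw [h0, map_zero]
    simp only [hL, map_add, map_mul, conj_conj] at h0'
    linear_combination (-p * conj p + q * conj q) * hnn + conj p * n * (hL.symm.trans h0) -
      n * conj q * h0'
  have hnu : ∀ u : ℂ, ((c + p * u + q * conj u) + z₁ * z₂ * conj (c + p * u + q * conj u)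
      = z₁ + z₂) ↔ d + 2 * (L * u).re = 0 := by
    intro u
    have e : ((d + 2 * (L * u).re : ℝ) : ℂ) = d + (L * u + conj (L * u)) := by
      rw [add_conj]; push_cast; ring
    rw [← ofReal_eq_zero, e, ← hd', hL]
    simp only [map_add, map_mul, conj_conj]
    have hz : n * (conj n * c + n * conj c - n * (conj z₁ + conj z₂) +
        ((conj n * p + n * conj q) * u + (n * conj p + conj n * q) * conj u)) =
        (c + p * u + q * conj u) + z₁ * z₂ * (conj c + conj p * conj u + conj q * u)
      - (z₁ + z₂) := by
      linear_combination (c + p * u + q * conj u) * hnn +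
        (conj c + conj p * conj u + conj q * u - conj z₁ - conj z₂) * hn - z₁ * h₂ - z₂ * h₁
    rw [← sub_eq_zero, ← hz, mul_eq_zero]
    simp [hn0]
  simp only [hnu]
  rw [existsUnique_unit_add_two_re_eq_zero_iff hL0, ← ofReal_inj]
  rw [← normSq_eq_norm_sq, ofReal_mul, ← mul_conj, ofReal_pow, ← hd', hL]
  push_cast
  simp only [map_add, map_mul, conj_conj]
  rw [← sub_eq_zero, ← sub_eq_zero (b := 4 * _ * _)]
  have hz : n ^ 2 * ((conj n * c + n * conj c - n * (conj z₁ + conj z₂)) ^ 2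
      - 4 * ((conj n * p + n * conj q) * (n * conj p + conj n * q))) =
      (c + z₁ * z₂ * conj c - z₁ - z₂) ^ 2
      - 4 * (p + z₁ * z₂ * conj q) * (q + z₁ * z₂ * conj p) := by
    have a1 : n * (conj n * c + n * conj c - n * (conj z₁ + conj z₂))
        = c + z₁ * z₂ * conj c - z₁ - z₂ := by
      linear_combination c * hnn + (conj c - conj z₁ - conj z₂) * hn - z₁ * h₂ - z₂ * h₁
    have a2 : n * (conj n * p + n * conj q) = p + z₁ * z₂ * conj q := by
      linear_combination p * hnn + conj q * hn
    have a3 : n * (n * conj p + conj n * q) = q + z₁ * z₂ * conj p := by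
      linear_combination q * hnn + conj p * hn
    rw [← a1, ← a2, ← a3]; ring
  rw [← hz, mul_eq_zero]
  simp [hn0]

/-- The foci of the ellipse `u ↦ c + p u + q ū` lie in each disc containing the ellipse. -/
theorem exists_foci_mem_ball {c p q : ℂ}
    (hin : ∀ u : ℂ, ‖u‖ = 1 → ‖c + p * u + q * conj u‖ < 1) :
    ∃ f g : ℂ, ‖f‖ < 1 ∧ ‖g‖ < 1 ∧ f + g = 2 * c ∧ f * g = c ^ 2 - 4 * p * q := by
  suffices H : ∃ r : ℂ, r ^ 2 = 4 * p * q ∧ ∃ (a : ℝ) (u : ℂ), ‖u‖ = 1 ∧ 0 ≤ a ∧ a ≤ 1 ∧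
      r = a * (p * u + q * conj u) by
    obtain ⟨r, hr, a, u, hu, ha0, ha1, hra⟩ := H
    have h1 := hin u hu
    have h2 := hin (-u) (by simpa using hu)
    set v := p * u + q * conj u with hv
    have e1 : c + p * u + q * conj u = c + v := by rw [hv]; ring
    have e2 : c + p * (-u) + q * conj (-u) = c - v := by rw [hv, map_neg]; ring
    rw [e1] at h1
    rw [e2] at h2
    have key : ∀ b : ℝ, -1 ≤ b → b ≤ 1 → ‖c + b * v‖ < 1 := by
      intro b hb0 hb1
      have e : c + b * v = ((1 + b) / 2 : ℝ) * (c + v) + ((1 - b) / 2 : ℝ) * (c - v) := by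
        push_cast; ring
      rw [e]
      refine (norm_add_le _ _).trans_lt ?_
      rw [norm_mul, norm_mul, norm_real, norm_real, Real.norm_of_nonneg (by linarith),
        Real.norm_of_nonneg (by linarith)]
      have hm := max_lt h1 h2
      have hl := mul_le_mul_of_nonneg_left (le_max_left ‖c + v‖ ‖c - v‖)
        (by linarith : 0 ≤ (1 + b) / 2)
      have hr := mul_le_mul_of_nonneg_left (le_max_right ‖c + v‖ ‖c - v‖)
        (by linarith : 0 ≤ (1 - b) / 2)
      linarith
    refine ⟨c + r, c - r, ?_, ?_, by ring, by linear_combination -hr⟩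
    · rw [hra]; exact key a (by linarith) ha1
    · have := key (-a) (by linarith) (by linarith)
      rw [hra]; push_cast at this; rwa [neg_mul, ← sub_eq_add_neg] at this
  by_cases hpq : p * q = 0
  · refine ⟨0, by linear_combination -4 * hpq, 0, 1, by simp, le_rfl, zero_le_one, by simp⟩
  · obtain ⟨v, hv⟩ : ∃ v : ℂ, v ^ 2 = p := IsAlgClosed.exists_pow_nat_eq _ two_pos
    obtain ⟨w, hw⟩ : ∃ w : ℂ, w ^ 2 = q := IsAlgClosed.exists_pow_nat_eq _ two_pos
    have hp0 : p ≠ 0 := left_ne_zero_of_mul hpq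
    have hq0 : q ≠ 0 := right_ne_zero_of_mul hpq
    have hv0 : v ≠ 0 := by rintro rfl; apply hp0; rw [← hv]; simp
    have hw0 : w ≠ 0 := by rintro rfl; apply hq0; rw [← hw]; simp
    set x := ‖v‖ with hx
    set y := ‖w‖ with hy
    have hx0 : 0 < x := norm_pos_iff.2 hv0
    have hy0 : 0 < y := norm_pos_iff.2 hw0
    have hvx : v * conj v = (x : ℂ) ^ 2 := by rw [mul_conj, normSq_eq_norm_sq]; push_cast; rfl
    have hwy : w * conj w = (y : ℂ) ^ 2 := by rw [mul_conj, normSq_eq_norm_sq]; push_cast; rfl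
    have hxc : (x : ℂ) ≠ 0 := by exact_mod_cast hx0.ne'
    have hyc : (y : ℂ) ≠ 0 := by exact_mod_cast hy0.ne'
    -- The foci `c ± r` lie on the major axis, whose ends are antipodal points of the ellipse. The
    -- semi-major axis is `|p| + |q| = x² + y²` and the focal distance is `2 x y`, so the ratio `a`
    -- is the eccentricity, and `u` is the parameter of an end of the axis. Convexity of the disc
    -- does the rest.
    refine ⟨2 * v * w, by rw [← hv, ← hw]; ring, 2 * x * y / (x ^ 2 + y ^ 2),
      w * x / (v * y), ?_, by positivity, ?_, ?_⟩
    · rw [norm_div, norm_mul, norm_mul, norm_real, norm_real, Real.norm_of_nonneg hx0.le,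
        Real.norm_of_nonneg hy0.le, ← hx, ← hy]
      field_simp
    · rw [div_le_one (by positivity)]; nlinarith [sq_nonneg (x - y)]
    · have hcv : conj v = x ^ 2 / v := by rw [← hvx]; field_simp
      have hcw : conj w = y ^ 2 / w := by rw [← hwy]; field_simp
      have hxy : (x : ℂ) ^ 2 + y ^ 2 ≠ 0 := by exact_mod_cast (by positivity : x ^ 2 + y ^ 2 ≠ 0)
      simp only [map_div₀, map_mul, conj_ofReal, hcv, hcw, ← hv, ← hw]
      push_cast
      field_simp

/-! ### Poncelet triangles as fibres of a Blaschke product -/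

/-- Three points of the unit circle with pairwise tangent chords are the roots of a cubic of the
Blaschke pencil. -/
theorem blaschke_of_tangent {s h M z₁ z₂ z₃ : ℂ}
    (h₁ : z₁ ≠ 0) (h₁₂ : z₁ ≠ z₂) (h₁₃ : z₁ ≠ z₃) (h₂₃ : z₂ ≠ z₃)
    (G₁₂ : (z₁ + z₂) ^ 2 - (z₁ + z₂) * (s + conj s * (z₁ * z₂)) + h + conj h * (z₁ * z₂) ^ 2
      + M * (z₁ * z₂) = 0)
    (G₁₃ : (z₁ + z₃) ^ 2 - (z₁ + z₃) * (s + conj s * (z₁ * z₃)) + h + conj h * (z₁ * z₃) ^ 2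
      + M * (z₁ * z₃) = 0)
    (G₂₃ : (z₂ + z₃) ^ 2 - (z₂ + z₃) * (s + conj s * (z₂ * z₃)) + h + conj h * (z₂ * z₃) ^ 2
      + M * (z₂ * z₃) = 0) :
    M = s * conj s - 1 - h * conj h ∧ z₁ + z₂ + z₃ = s + conj h * (z₁ * z₂ * z₃) ∧
      z₁ * z₂ + z₁ * z₃ + z₂ * z₃ = h + conj s * (z₁ * z₂ * z₃) := by
  have d₁₂ := sub_ne_zero.2 h₁₂
  have d₁₃ := sub_ne_zero.2 h₁₃
  have d₂₃ := sub_ne_zero.2 h₂₃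
  -- For fixed `x` the tangency relation is quadratic in the other endpoint, and its roots are the
  -- two remaining vertices. Vieta's product says that `x` satisfies the cubic with `l = x y w`;
  -- Vieta's sum later determines `M`.
  have root : ∀ x y w : ℂ, y ≠ w →
      (x + y) ^ 2 - (x + y) * (s + conj s * (x * y)) + h + conj h * (x * y) ^ 2
        + M * (x * y) = 0 →
      (x + w) ^ 2 - (x + w) * (s + conj s * (x * w)) + h + conj h * (x * w) ^ 2
        + M * (x * w) = 0 →
      x * (x ^ 2 - s * x + h) = x * y * w * (1 - conj s * x + conj h * x ^ 2) ∧
      (1 - conj s * x + conj h * x ^ 2) * (y + w) + ((2 + M) * x - s - conj s * x ^ 2) = 0 := by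
    intro x y w hyw hy hw
    have d := sub_ne_zero.2 hyw
    have e1 : (1 - conj s * x + conj h * x ^ 2) * (y + w)
        + ((2 + M) * x - s - conj s * x ^ 2) = 0 := by
      apply mul_left_cancel₀ d
      linear_combination hy - hw
    refine ⟨?_, e1⟩
    linear_combination -x * y * e1 + x * hy
  obtain ⟨r₁, t₁⟩ := root z₁ z₂ z₃ h₂₃ G₁₂ G₁₃
  obtain ⟨r₂, -⟩ := root z₂ z₁ z₃ h₁₃ (by linear_combination G₁₂) G₂₃
  obtain ⟨r₃, -⟩ := root z₃ z₁ z₂ h₁₂ (by linear_combination G₁₃) (by linear_combination G₂₃)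
  have q₁₂ : z₁ ^ 2 + z₁ * z₂ + z₂ ^ 2 - s * (z₁ + z₂) + h
      + z₁ * z₂ * z₃ * (conj s - conj h * (z₁ + z₂)) = 0 := by
    apply mul_left_cancel₀ d₁₂
    linear_combination r₁ - r₂
  have q₁₃ : z₁ ^ 2 + z₁ * z₃ + z₃ ^ 2 - s * (z₁ + z₃) + h
      + z₁ * z₂ * z₃ * (conj s - conj h * (z₁ + z₃)) = 0 := by
    apply mul_left_cancel₀ d₁₃
    linear_combination r₁ - r₃
  have e₁ : z₁ + z₂ + z₃ = s + conj h * (z₁ * z₂ * z₃) := by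
    apply mul_left_cancel₀ d₂₃
    linear_combination q₁₂ - q₁₃
  have e₂ : z₁ * z₂ + z₁ * z₃ + z₂ * z₃ = h + conj s * (z₁ * z₂ * z₃) := by
    linear_combination -q₁₂ + (z₁ + z₂) * e₁
  refine ⟨?_, e₁, e₂⟩
  apply mul_left_cancel₀ h₁
  linear_combination t₁ - (1 - conj s * z₁ + conj h * z₁ ^ 2) * e₁ + conj h * r₁

/-- The chord between two roots of a cubic of the Blaschke pencil is tangent. -/
theorem tangent_of_blaschke {s h M z₁ z₂ z₃ : ℂ} (hM : M = s * conj s - 1 - h * conj h)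
    (h₃ : z₃ ≠ 0) (e₁ : z₁ + z₂ + z₃ = s + conj h * (z₁ * z₂ * z₃))
    (e₂ : z₁ * z₂ + z₁ * z₃ + z₂ * z₃ = h + conj s * (z₁ * z₂ * z₃)) :
    (z₁ + z₂) ^ 2 - (z₁ + z₂) * (s + conj s * (z₁ * z₂)) + h + conj h * (z₁ * z₂) ^ 2
      + M * (z₁ * z₂) = 0 := by
  apply mul_left_cancel₀ h₃
  rw [hM]
  linear_combination (z₃ * (z₁ + z₂) - z₃ * conj s * (z₁ * z₂)) * e₁ -
     z₃ * (1 - conj h * (z₁ * z₂)) * e₂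

/-- This gives the comparison of a Blaschke factor with 1: its modulus is below 1 inside the disc
and above 1 outside. -/
theorem norm_one_sub_conj_mul_sq_sub (f z : ℂ) :
    ‖1 - conj f * z‖ ^ 2 - ‖z - f‖ ^ 2 = (1 - ‖z‖ ^ 2) * (1 - ‖f‖ ^ 2) := by
  simp only [← normSq_eq_norm_sq, normSq_apply]
  simp
  ring

/-- The roots of a cubic of the Blaschke pencil are unimodular. -/
theorem norm_eq_one_of_blaschke {f g l z : ℂ} (hf : ‖f‖ < 1) (hg : ‖g‖ < 1) (hl : ‖l‖ = 1)
    (hz : z * ((z - f) * (z - g)) = l * ((1 - conj f * z) * (1 - conj g * z))) : ‖z‖ = 1 := by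
  have hn : ‖z‖ * (‖z - f‖ * ‖z - g‖) = ‖1 - conj f * z‖ * ‖1 - conj g * z‖ := by
    have := congrArg norm hz
    simpa only [norm_mul, hl, one_mul] using this
  have hf' := norm_one_sub_conj_mul_sq_sub f z
  have hg' := norm_one_sub_conj_mul_sq_sub g z
  have hf2 : 0 < 1 - ‖f‖ ^ 2 := by nlinarith [norm_nonneg f]
  have hg2 : 0 < 1 - ‖g‖ ^ 2 := by nlinarith [norm_nonneg g]
  rcases lt_trichotomy ‖z‖ 1 with h | h | h
  · have hz2 : 0 < 1 - ‖z‖ ^ 2 := by nlinarith [norm_nonneg z]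
    have a1 : ‖z - f‖ < ‖1 - conj f * z‖ :=
      lt_of_pow_lt_pow_left₀ 2 (norm_nonneg _) (by nlinarith [mul_pos hz2 hf2])
    have a2 : ‖z - g‖ < ‖1 - conj g * z‖ :=
      lt_of_pow_lt_pow_left₀ 2 (norm_nonneg _) (by nlinarith [mul_pos hz2 hg2])
    have a3 : ‖z - f‖ * ‖z - g‖ < ‖1 - conj f * z‖ * ‖1 - conj g * z‖ :=
      mul_lt_mul'' a1 a2 (norm_nonneg _) (norm_nonneg _)
    have a4 : 0 ≤ ‖z - f‖ * ‖z - g‖ := by positivity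
    nlinarith
  · exact h
  · have hz2 : 0 < ‖z‖ ^ 2 - 1 := by nlinarith [norm_nonneg z]
    have a1 : ‖1 - conj f * z‖ < ‖z - f‖ :=
      lt_of_pow_lt_pow_left₀ 2 (norm_nonneg _) (by nlinarith [mul_pos hz2 hf2])
    have a2 : ‖1 - conj g * z‖ < ‖z - g‖ :=
      lt_of_pow_lt_pow_left₀ 2 (norm_nonneg _) (by nlinarith [mul_pos hz2 hg2])
    have a3 : ‖1 - conj f * z‖ * ‖1 - conj g * z‖ < ‖z - f‖ * ‖z - g‖ :=
      mul_lt_mul'' a1 a2 (norm_nonneg _) (norm_nonneg _)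
    have a4 : 0 ≤ ‖z - f‖ * ‖z - g‖ := by positivity
    nlinarith

theorem exists_roots_cubic (e₁ e₂ e₃ : ℂ) :
    ∃ x y z : ℂ, x + y + z = e₁ ∧ x * y + x * z + y * z = e₂ ∧ x * y * z = e₃ := by
  set C : Cubic ℂ := ⟨1, -e₁, e₂, -e₃⟩ with hC
  have ha : C.a ≠ 0 := one_ne_zero
  obtain ⟨x, y, z, h3⟩ := (Cubic.splits_iff_roots_eq_three (φ := RingHom.id ℂ) ha).1
    (IsAlgClosed.splits _)
  have hb := Cubic.b_eq_three_roots ha h3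
  have hc := Cubic.c_eq_three_roots ha h3
  have hd := Cubic.d_eq_three_roots ha h3
  simp only [hC, RingHom.id_apply] at hb hc hd
  exact ⟨x, y, z, by linear_combination hb, by linear_combination -hc, by linear_combination hd⟩

/-- The vertices of a Poncelet triangle of the unit circle, as roots of a cubic
`x³ - s x² + h x - l (1 - s̄ x + h̄ x²)` of a Blaschke pencil. -/
structure IsBlaschkeTriple (s h z₁ z₂ z₃ : ℂ) : Prop where
  unit₁ : z₁ * conj z₁ = 1
  unit₂ : z₂ * conj z₂ = 1
  unit₃ : z₃ * conj z₃ = 1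
  ne₁₂ : z₁ ≠ z₂
  ne₁₃ : z₁ ≠ z₃
  ne₂₃ : z₂ ≠ z₃
  sum : z₁ + z₂ + z₃ = s + conj h * (z₁ * z₂ * z₃)
  sum_mul : z₁ * z₂ + z₁ * z₃ + z₂ * z₃ = h + conj s * (z₁ * z₂ * z₃)

theorem IsBlaschkeTriple.rotate {s h z₁ z₂ z₃ : ℂ} (H : IsBlaschkeTriple s h z₁ z₂ z₃) :
    IsBlaschkeTriple s h z₂ z₃ z₁ where
  unit₁ := H.unit₂
  unit₂ := H.unit₃
  unit₃ := H.unit₁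
  ne₁₂ := H.ne₂₃
  ne₁₃ := H.ne₁₂.symm
  ne₂₃ := H.ne₁₃.symm
  sum := by linear_combination H.sum
  sum_mul := by linear_combination H.sum_mul

theorem IsBlaschkeTriple.norm_mul_eq_one {s h z₁ z₂ z₃ : ℂ}
    (H : IsBlaschkeTriple s h z₁ z₂ z₃) : ‖z₁ * z₂ * z₃‖ = 1 := by
  rw [norm_mul, norm_mul, norm_eq_one_iff_mul_conj.2 H.unit₁, norm_eq_one_iff_mul_conj.2 H.unit₂,
    norm_eq_one_iff_mul_conj.2 H.unit₃]; norm_num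

theorem mem_ellipse_iff {φ : ℂ ≃ᵃ[ℝ] ℂ} {X : ℂ} : X ∈ ellipse φ ↔ ∃ z, ‖z‖ = 1 ∧ φ z = X := by
  simp [ellipse]

theorem apply_mem_ellipse_iff {φ : ℂ ≃ᵃ[ℝ] ℂ} {z : ℂ} : φ z ∈ ellipse φ ↔ ‖z‖ = 1 := by
  rw [mem_ellipse_iff]
  constructor
  · rintro ⟨w, hw, h⟩
    rwa [← φ.injective h]
  · intro h
    exact ⟨z, h, rfl⟩

theorem isTangentLine_iff {φ ψ : ℂ ≃ᵃ[ℝ] ℂ} {c p q z₁ z₂ : ℂ}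
    (hχ : ∀ u, φ.symm (ψ u) = c + p * u + q * conj u) (hpq : p * conj p - q * conj q ≠ 0)
    (h₁ : z₁ * conj z₁ = 1) (h₂ : z₂ * conj z₂ = 1) (h₁₂ : z₁ ≠ z₂) :
    IsTangentLine (ellipse ψ) (φ z₁) (φ z₂) ↔
    (c + z₁ * z₂ * conj c - z₁ - z₂) ^ 2
      = 4 * (p + z₁ * z₂ * conj q) * (q + z₁ * z₂ * conj p) := by
  rw [← existsUnique_chord_inter_iff hpq h₁ h₂]
  have hmem : ∀ u, ψ u ∈ line[ℝ, φ z₁, φ z₂] ↔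
      (c + p * u + q * conj u) + z₁ * z₂ * conj (c + p * u + q * conj u) = z₁ + z₂ := by
    intro u
    rw [← hχ, ← mem_chord_iff h₁ h₂ h₁₂, ← map_mem_line_iff φ (X := φ.symm (ψ u)),
      AffineEquiv.apply_symm_apply]
  constructor
  · rintro ⟨Z, ⟨hZ, hZ'⟩, huniq⟩
    obtain ⟨u, hu, rfl⟩ := mem_ellipse_iff.1 hZ'
    exact ⟨u, ⟨hu, (hmem u).1 hZ⟩, fun v hv => ψ.injective
      (huniq (ψ v) ⟨(hmem v).2 hv.2, apply_mem_ellipse_iff.2 hv.1⟩)⟩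
  · rintro ⟨u, ⟨hu, hu'⟩, huniq⟩
    refine ⟨ψ u, ⟨(hmem u).2 hu', apply_mem_ellipse_iff.2 hu⟩, ?_⟩
    rintro Z ⟨hZ, hZ'⟩
    obtain ⟨v, hv, rfl⟩ := mem_ellipse_iff.1 hZ'
    rw [huniq v ⟨hv, (hmem v).1 hZ⟩]

theorem affineIndependent_of_unit (φ : ℂ ≃ᵃ[ℝ] ℂ) {z₁ z₂ z₃ : ℂ} (h₁ : z₁ * conj z₁ = 1)
    (h₂ : z₂ * conj z₂ = 1) (h₃ : z₃ * conj z₃ = 1) (h₁₂ : z₁ ≠ z₂) (h₁₃ : z₁ ≠ z₃)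
    (h₂₃ : z₂ ≠ z₃) : AffineIndependent ℝ ![φ z₁, φ z₂, φ z₃] := by
  have hc : Cospherical ({z₁, z₂, z₃} : Set ℂ) := by
    refine ⟨0, 1, ?_⟩
    rintro x (rfl | rfl | rfl) <;> rw [dist_zero_right, norm_eq_one_iff_mul_conj] <;> assumption
  have := (φ.affineIndependent_iff).2 (hc.affineIndependent_of_ne h₁₂ h₁₃ h₂₃)
  convert this using 1
  ext i
  fin_cases i <;> rfl

/-- Poncelet's porism for triangles: if there is a Poncelet triangle, then the family is
parametrized by the unit circle through a Blaschke pencil. -/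
theorem exists_isPonceletTriangle_iff {φ ψ : ℂ ≃ᵃ[ℝ] ℂ}
    (hnested : ellipse ψ ⊆ ellipseInterior φ)
    (hex : ∃ A B C, IsPonceletTriangle (ellipse φ) (ellipse ψ) A B C) :
    ∃ s h : ℂ, ‖h‖ < 1 ∧
      (∀ A B C, IsPonceletTriangle (ellipse φ) (ellipse ψ) A B C ↔
        ∃ z₁ z₂ z₃, IsBlaschkeTriple s h z₁ z₂ z₃ ∧ φ z₁ = A ∧ φ z₂ = B ∧ φ z₃ = C) ∧
      ∀ l : ℂ, ‖l‖ = 1 → ∃ z₁ z₂ z₃, IsBlaschkeTriple s h z₁ z₂ z₃ ∧ z₁ * z₂ * z₃ = l := by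
  obtain ⟨c, p, q, hχ, hpq⟩ := exists_affineEquiv_eq (ψ.trans φ.symm)
  replace hχ : ∀ u, φ.symm (ψ u) = c + p * u + q * conj u := hχ
  have hin : ∀ u : ℂ, ‖u‖ = 1 → ‖c + p * u + q * conj u‖ < 1 := by
    intro u hu
    obtain ⟨v, hv, hv'⟩ := hnested (apply_mem_ellipse_iff.2 hu)
    rw [← hχ, ← hv', AffineEquiv.symm_apply_apply]
    simpa using hv
  obtain ⟨f, g, hf, hg, hs, hh⟩ := exists_foci_mem_ball hin
  set s := f + g with hs'
  set h := f * g with hh'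
  set M : ℂ := 2 * c * conj c - 4 * (p * conj p + q * conj q) with hM
  have hsc : conj s = 2 * conj c := by rw [hs, map_mul, conj_ofNat]
  have hhc : conj h = conj c ^ 2 - 4 * conj p * conj q := by
    rw [hh, map_sub, map_pow, map_mul, map_mul, conj_ofNat]
  have tan : ∀ z₁ z₂ : ℂ, (c + z₁ * z₂ * conj c - z₁ - z₂) ^ 2
      = 4 * (p + z₁ * z₂ * conj q) * (q + z₁ * z₂ * conj p) ↔
      (z₁ + z₂) ^ 2 - (z₁ + z₂) * (s + conj s * (z₁ * z₂)) + h + conj h * (z₁ * z₂) ^ 2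
      + M * (z₁ * z₂) = 0 := by
    intro z₁ z₂
    rw [hsc, hhc, hs, hh, hM, ← sub_eq_zero]
    ring_nf
  have fwd : ∀ A B C, IsPonceletTriangle (ellipse φ) (ellipse ψ) A B C →
      M = s * conj s - 1 - h * conj h ∧
      ∃ z₁ z₂ z₃, IsBlaschkeTriple s h z₁ z₂ z₃ ∧ φ z₁ = A ∧ φ z₂ = B ∧ φ z₃ = C := by
    intro A B C T
    obtain ⟨z₁, u₁, rfl⟩ := mem_ellipse_iff.1 T.mem_A
    obtain ⟨z₂, u₂, rfl⟩ := mem_ellipse_iff.1 T.mem_B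
    obtain ⟨z₃, u₃, rfl⟩ := mem_ellipse_iff.1 T.mem_C
    rw [norm_eq_one_iff_mul_conj] at u₁ u₂ u₃
    have inj := T.nondegenerate.injective
    have h₁₂ : z₁ ≠ z₂ := fun e => by
      have : (0 : Fin 3) = 1 := inj (by simp [e])
      simp at this
    have h₁₃ : z₁ ≠ z₃ := fun e => by
      have : (0 : Fin 3) = 2 := inj (by simp [e])
      simp at this
    have h₂₃ : z₂ ≠ z₃ := fun e => by
      have : (1 : Fin 3) = 2 := inj (by simp [e])
      simp at this
    have G₁₂ := (tan _ _).1 ((isTangentLine_iff hχ hpq u₁ u₂ h₁₂).1 T.tangent_AB)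
    have G₂₃ := (tan _ _).1 ((isTangentLine_iff hχ hpq u₂ u₃ h₂₃).1 T.tangent_BC)
    have G₃₁ := (tan _ _).1 ((isTangentLine_iff hχ hpq u₃ u₁ h₁₃.symm).1 T.tangent_CA)
    obtain ⟨hM', e₁, e₂⟩ := blaschke_of_tangent (left_ne_zero_of_mul_eq_one u₁) h₁₂ h₁₃ h₂₃ G₁₂
      (by linear_combination G₃₁) G₂₃
    exact ⟨hM', z₁, z₂, z₃, ⟨u₁, u₂, u₃, h₁₂, h₁₃, h₂₃, e₁, e₂⟩, rfl, rfl, rfl⟩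
  obtain ⟨A₀, B₀, C₀, T₀⟩ := hex
  -- This is where the porism enters: the relation on `M` involves the two conics only, so a single
  -- triangle establishes it for every `l`.
  have hM' := (fwd _ _ _ T₀).1
  refine ⟨s, h, ?_, ?_, ?_⟩
  · rw [hh', norm_mul]; nlinarith [norm_nonneg f, norm_nonneg g]
  · intro A B C
    refine ⟨fun T => (fwd A B C T).2, ?_⟩
    rintro ⟨z₁, z₂, z₃, H, rfl, rfl, rfl⟩
    have n₁ := left_ne_zero_of_mul_eq_one H.unit₁
    have n₂ := left_ne_zero_of_mul_eq_one H.unit₂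
    have n₃ := left_ne_zero_of_mul_eq_one H.unit₃
    refine ⟨affineIndependent_of_unit φ H.unit₁ H.unit₂ H.unit₃ H.ne₁₂ H.ne₁₃ H.ne₂₃,
      apply_mem_ellipse_iff.2 (norm_eq_one_iff_mul_conj.2 H.unit₁),
      apply_mem_ellipse_iff.2 (norm_eq_one_iff_mul_conj.2 H.unit₂),
      apply_mem_ellipse_iff.2 (norm_eq_one_iff_mul_conj.2 H.unit₃),
      (isTangentLine_iff hχ hpq H.unit₂ H.unit₃ H.ne₂₃).2 ((tan _ _).2 ?_),
      (isTangentLine_iff hχ hpq H.unit₃ H.unit₁ H.ne₁₃.symm).2 ((tan _ _).2 ?_),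
      (isTangentLine_iff hχ hpq H.unit₁ H.unit₂ H.ne₁₂).2 ((tan _ _).2 ?_)⟩
    · exact tangent_of_blaschke hM' n₁ H.rotate.sum H.rotate.sum_mul
    · exact tangent_of_blaschke hM' n₂ H.rotate.rotate.sum H.rotate.rotate.sum_mul
    · exact tangent_of_blaschke hM' n₃ H.sum H.sum_mul
  · intro l hl
    obtain ⟨z₁, z₂, z₃, e₁, e₂, e₃⟩ := exists_roots_cubic (s + conj h * l) (h + conj s * l) l
    have hl0 : l ≠ 0 := norm_ne_zero_iff.1 (by rw [hl]; exact one_ne_zero)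
    have unit : ∀ x y w : ℂ, x + y + w = s + conj h * l → x * y + x * w + y * w = h + conj s * l →
        x * y * w = l → x * conj x = 1 := by
      intro x y w e₁ e₂ e₃
      rw [← norm_eq_one_iff_mul_conj]
      refine norm_eq_one_of_blaschke hf hg hl ?_
      rw [hs', map_add] at e₂
      rw [hs'] at e₁
      rw [hh', map_mul] at e₁
      rw [hh'] at e₂
      linear_combination x ^ 2 * e₁ - x * e₂ + e₃
    -- At a double root `x` the tangent chord degenerates to the tangent of the unit circle at `x`.
    -- It would contain a point `k` of the inner ellipse with `Re (k x̄) = 1`, contradicting `|k| <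
    -- 1`.
    have ne : ∀ x y w : ℂ, x + y + w = s + conj h * l → x * y + x * w + y * w = h + conj s * l →
        x * y * w = l → x ≠ y := by
      rintro x y w e₁ e₂ e₃ rfl
      have ux := unit x x w e₁ e₂ e₃
      have hw : w ≠ 0 := right_ne_zero_of_mul (e₃ ▸ hl0)
      obtain ⟨u, ⟨hu, hu'⟩, -⟩ := (existsUnique_chord_inter_iff hpq ux ux).2 ((tan _ _).2
        (tangent_of_blaschke hM' hw (by rw [e₃]; exact e₁) (by rw [e₃]; exact e₂)))
      have hlt := hin u hu
      set k := c + p * u + q * conj u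
      have hx0 : x ≠ 0 := left_ne_zero_of_mul_eq_one ux
      have hk : k * conj x + conj (k * conj x) = 2 := by
        rw [map_mul, conj_conj]
        apply mul_left_cancel₀ hx0
        linear_combination hu' + k * ux
      rw [add_conj] at hk
      have hre : (k * conj x).re = 1 := by
        have : 2 * (k * conj x).re = 2 := by exact_mod_cast hk
        linarith
      have hle := re_le_norm (k * conj x)
      rw [norm_mul, norm_conj, norm_eq_one_iff_mul_conj.2 ux, hre] at hle
      linarith
    refine ⟨z₁, z₂, z₃, ⟨unit z₁ z₂ z₃ e₁ e₂ e₃,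
      unit z₂ z₁ z₃ (by linear_combination e₁) (by linear_combination e₂)
        (by linear_combination e₃),
      unit z₃ z₁ z₂ (by linear_combination e₁) (by linear_combination e₂)
        (by linear_combination e₃), ne z₁ z₂ z₃ e₁ e₂ e₃,
      ne z₁ z₃ z₂ (by linear_combination e₁) (by linear_combination e₂)
        (by linear_combination e₃),
      ne z₂ z₃ z₁ (by linear_combination e₁) (by linear_combination e₂)
        (by linear_combination e₃), by rw [e₃]; exact e₁, by rw [e₃]; exact e₂⟩, e₃⟩

/-! ### The power of a point with respect to the circumcircles -/

/-- The part of the power of a point that is constant over the Poncelet family. -/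
def powerConst (p q s h Z : ℂ) : ℝ :=
  2 * (p * conj q * (Z ^ 2 - s * Z + h)).re + (normSq p + normSq q) * (normSq Z - 1)

/-- The coefficient of the part of the power of a point that varies over the Poncelet family. -/
def powerCoeff (p q s h Z : ℂ) : ℂ :=
  p * conj q * (conj s - conj h * Z - conj Z)

/-- The power of the image of `Z` with respect to the circumcircle of the Poncelet triangle with
parameter `l`. -/
def power (p q s h l Z : ℂ) : ℝ :=
  powerConst p q s h Z + 2 * (powerCoeff p q s h Z * l).re

theorem ofReal_powerConst (p q s h Z : ℂ) : (powerConst p q s h Z : ℂ) =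
    p * conj q * (Z ^ 2 - s * Z + h) + conj p * q * (conj Z ^ 2 - conj s * conj Z + conj h) +
      (p * conj p + q * conj q) * (Z * conj Z - 1) := by
  have : ((2 * (p * conj q * (Z ^ 2 - s * Z + h)).re : ℝ) : ℂ) = p * conj q * (Z ^ 2 - s * Z + h) +
      conj (p * conj q * (Z ^ 2 - s * Z + h)) := by rw [add_conj]
  rw [powerConst, ofReal_add, this, ofReal_mul, ofReal_add, ofReal_sub, mul_conj, mul_conj, mul_conj]
  simp

theorem ofReal_power (p q s h l Z : ℂ) : (power p q s h l Z : ℂ) =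
    powerConst p q s h Z + powerCoeff p q s h Z * l + conj (powerCoeff p q s h Z) * conj l := by
  have : ((2 * (powerCoeff p q s h Z * l).re : ℝ) : ℂ) = powerCoeff p q s h Z * l +
      conj (powerCoeff p q s h Z * l) := by rw [add_conj]
  rw [power, ofReal_add, this, map_mul, add_assoc]

namespace IsBlaschkeTriple

variable {s h z₁ z₂ z₃ : ℂ} (H : IsBlaschkeTriple s h z₁ z₂ z₃)
include H

theorem unit_mul : z₁ * z₂ * z₃ * conj (z₁ * z₂ * z₃) = 1 :=
  norm_eq_one_iff_mul_conj.1 H.norm_mul_eq_one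

/-- The quadratic part in `Z` is that of `|φ Z|²`, so the zero set is a circle in the original
metric. On the unit circle the bracket equals `(Z - z₁)(Z - z₂)(Z - z₃) / Z`, so it vanishes at the
vertices. -/
theorem power_eq (p q Z : ℂ) : (power p q s h (z₁ * z₂ * z₃) Z : ℂ) =
    p * conj q * (Z ^ 2 - (z₁ + z₂ + z₃) * Z + (z₁ * z₂ + z₁ * z₃ + z₂ * z₃)
      - z₁ * z₂ * z₃ * conj Z) +
    conj p * q * conj (Z ^ 2 - (z₁ + z₂ + z₃) * Z + (z₁ * z₂ + z₁ * z₃ + z₂ * z₃)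
      - z₁ * z₂ * z₃ * conj Z) + (p * conj p + q * conj q) * (Z * conj Z - 1) := by
  rw [ofReal_power, ofReal_powerConst, powerCoeff, H.sum, H.sum_mul]
  simp only [map_add, map_sub, map_mul, map_pow, conj_conj]
  ring

theorem power_vertex (p q : ℂ) : power p q s h (z₁ * z₂ * z₃) z₁ = 0 := by
  have h0 : z₁ ^ 2 - (z₁ + z₂ + z₃) * z₁ + (z₁ * z₂ + z₁ * z₃ + z₂ * z₃)
      - z₁ * z₂ * z₃ * conj z₁ = 0 := by linear_combination -z₂ * z₃ * H.unit₁
  rw [← ofReal_eq_zero, H.power_eq, h0, H.unit₁]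
  simp

/-- The power is the difference between the squared distance to the circumcenter and the squared
circumradius. -/
theorem exists_center {φ : ℂ ≃ᵃ[ℝ] ℂ} {a p q : ℂ} (hφ : ∀ z, φ z = a + p * z + q * conj z)
    (hpq : p * conj p - q * conj q ≠ 0) :
    ∃ o : ℂ, ∃ r : ℝ, ∀ Z, dist (φ Z) o ^ 2 = power p q s h (z₁ * z₂ * z₃) Z + r := by
  -- `α` is minus the coefficient of `Z` in the power. Matching linear terms with `|φ Z - (a + o)|²`
  -- gives the system `ō p + o q̄ = α` and its conjugate, solvable since `|p| ≠ |q|`.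
  set α := p * conj q * (z₁ + z₂ + z₃) + conj p * q * conj (z₁ * z₂ * z₃) with hα
  set o := (p * conj α - q * α) / (p * conj p - q * conj q) with ho
  have hco : conj o = (conj p * α - conj q * conj α) / (p * conj p - q * conj q) := by
    rw [ho]; simp only [map_div₀, map_sub, map_mul, conj_conj]; ring
  have e1 : conj o * p + o * conj q = α := by
    rw [hco, ho, div_mul_eq_mul_div, div_mul_eq_mul_div, ← add_div, div_eq_iff hpq]; ring
  have e2 : conj o * q + o * conj p = conj α := by
    rw [hco, ho, div_mul_eq_mul_div, div_mul_eq_mul_div, ← add_div, div_eq_iff hpq]; ring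
  set κ := p * conj q * (z₁ * z₂ + z₁ * z₃ + z₂ * z₃) with hκ
  refine ⟨a + o, normSq o - 2 * κ.re + (normSq p + normSq q), fun Z => ?_⟩
  have hk : ((2 * κ.re : ℝ) : ℂ) = κ + conj κ := (add_conj κ).symm
  rw [← ofReal_inj, dist_eq, ← normSq_eq_norm_sq, ← mul_conj, ofReal_add, ofReal_add, ofReal_sub, hk,
    ofReal_add, H.power_eq, hφ]
  rw [← mul_conj, ← mul_conj, ← mul_conj]
  simp only [hα, hκ, map_add, map_sub, map_mul, map_pow, conj_conj] at e1 e2 ⊢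
  linear_combination -Z * e1 - conj Z * e2

theorem apply_mem_circumcircle_iff {φ : ℂ ≃ᵃ[ℝ] ℂ} {a p q : ℂ}
    (hφ : ∀ z, φ z = a + p * z + q * conj z)
    (hpq : p * conj p - q * conj q ≠ 0) (Z : ℂ) :
    φ Z ∈ circumcircle (φ z₁) (φ z₂) (φ z₃) ↔ power p q s h (z₁ * z₂ * z₃) Z = 0 := by
  obtain ⟨o, r, hor⟩ := H.exists_center hφ hpq
  have v1 := hor z₁
  have v2 := hor z₂
  have v3 := hor z₃
  rw [H.power_vertex, zero_add] at v1
  have hr2 := H.rotate.power_vertex p q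
  have hr3 := H.rotate.rotate.power_vertex p q
  rw [show z₂ * z₃ * z₁ = z₁ * z₂ * z₃ by ring] at hr2
  rw [show z₃ * z₁ * z₂ = z₁ * z₂ * z₃ by ring] at hr3
  rw [hr2, zero_add] at v2
  rw [hr3, zero_add] at v3
  have eqd : ∀ {X Y : ℂ}, dist X o ^ 2 = r → dist Y o ^ 2 = r → dist X o = dist Y o :=
    fun hX hY => (pow_left_inj₀ dist_nonneg dist_nonneg two_ne_zero).1 (hX.trans hY.symm)
  constructor
  · rintro ⟨o', r', hc⟩
    have c1 : dist (φ z₁) o' = r' := hc _ (by simp)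
    have c2 : dist (φ z₂) o' = r' := hc _ (by simp)
    have c3 : dist (φ z₃) o' = r' := hc _ (by simp)
    have c4 : dist (φ Z) o' = r' := hc _ (by simp)
    have hsq : ∀ X Y : ℂ, ((dist X Y ^ 2 : ℝ) : ℂ) = (X - Y) * (conj X - conj Y) := by
      intro X Y
      rw [dist_eq, ← normSq_eq_norm_sq, ← mul_conj, map_sub]
    have lin : ∀ X Y : ℂ, dist X o ^ 2 = dist Y o ^ 2 → dist X o' = dist Y o' →
        (X - Y) * (conj o' - conj o) + (conj X - conj Y) * (o' - o) = 0 := by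
      intro X Y h1 h2
      have h1' := congrArg (fun x : ℝ => (x : ℂ)) h1
      have h2' := congrArg (fun x : ℝ => ((x ^ 2 : ℝ) : ℂ)) h2
      simp only [hsq] at h1' h2'
      linear_combination h1' - h2'
    have l12 := lin _ _ (v1.trans v2.symm) (c1.trans c2.symm)
    have l13 := lin _ _ (v1.trans v3.symm) (c1.trans c3.symm)
    have n₁ := left_ne_zero_of_mul_eq_one H.unit₁
    have d₂₃ := sub_ne_zero.2 H.ne₂₃
    -- Equidistance from the three vertices gives two linear equations for `o' - o`; after division
    -- by chord differences these become `k12` and `k13`, whose only solution is zero.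
    have hoo : o' = o := by
      have red : ∀ x y : ℂ, x * conj x = 1 → y * conj y = 1 → x ≠ y →
          (φ x - φ y) * (conj o' - conj o) + (conj (φ x) - conj (φ y)) * (o' - o) = 0 →
          (p * (x * y) - q) * (conj o' - conj o) + (conj q * (x * y) - conj p) * (o' - o) = 0 := by
        intro x y hx hy hxy hl
        apply mul_left_cancel₀ (sub_ne_zero.2 hxy)
        rw [hφ, hφ] at hl
        simp only [map_add, map_mul, conj_conj] at hl
        linear_combination x * y * hl + (-y * hx + x * hy) * (q * (conj o' - conj o)
          + conj p * (o' - o))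
      have k12 := red _ _ H.unit₁ H.unit₂ H.ne₁₂ l12
      have k13 := red _ _ H.unit₁ H.unit₃ H.ne₁₃ l13
      have m1 : p * (conj o' - conj o) + conj q * (o' - o) = 0 := by
        apply mul_left_cancel₀ (mul_ne_zero n₁ d₂₃)
        linear_combination k12 - k13
      rw [← sub_eq_zero]
      apply mul_left_cancel₀ hpq
      linear_combination p * (z₁ * z₂ * m1 - k12) - q * m1
    rw [hoo] at c1 c4
    have := hor Z
    rw [c4, ← c1, v1] at this
    linarith
  · intro h0
    refine ⟨o, dist (φ z₁) o, ?_⟩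
    have v4 := hor Z
    rw [h0, zero_add] at v4
    rintro X (rfl | rfl | rfl | rfl)
    · rfl
    · exact eqd v2 v1
    · exact eqd v3 v1
    · exact eqd v4 v1

end IsBlaschkeTriple

/-! ### The isogonal conjugate as a function of the parameter -/

/-- The outer coefficients of the numerator of the isogonal conjugate, as polynomials in which
conjugate quantities are independent variables. -/
def isogonalOuter (p q p' q' s' t Z Z' : ℂ) : ℂ :=
  p * (-(p * p') * (Z' ^ 2 - s' * Z' + t) + p * q' * (t * Z ^ 2 - s' * Z + 1)
    + q * p' * t * (Z' ^ 2 - s' * Z' + t)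
    + q * q' * (2 * t * Z * Z' - s' * t * Z + Z' ^ 2 - 2 * s' * Z' + s' ^ 2 - t))

/-- One half of the middle coefficient of the numerator of the isogonal conjugate. -/
def isogonalMiddle (p q p' q' s s' h t Z Z' : ℂ) : ℂ :=
  p ^ 2 * p' * (-Z ^ 2 * Z' + 2 * Z + h * Z' - s) - p ^ 2 * q' * Z * (Z ^ 2 - s * Z + h)
    + p * p' * q * (-2 * Z * Z' ^ 2 + 2 * s' * Z * Z' - 2 * t * Z + s * Z' ^ 2 - s * s' * Z'
      - h * t * Z' + Z' + 2 * s * t - s')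

/-- Read with primes as conjugates and `t = h̄`, this is `N + (P - A) · power = conj (A - P) · β (B
- A)(C - A)`, with `β` the barycentric coordinate of `P` at `A`. Dividing by the power shows that
`(P - A)(Q - A)` is a real multiple of `(B - A)(C - A)` for `Q = P + N / power`. -/
theorem isogonal_identity {p q p' q' s s' h t Z Z' z₁ z₂ z₃ : ℂ} (h₁ : z₁ ≠ 0) (h₂ : z₂ ≠ 0)
    (h₃ : z₃ ≠ 0) (hs : z₁ + z₂ + z₃ = s + t * (z₁ * z₂ * z₃))
    (hh : z₁ * z₂ + z₁ * z₃ + z₂ * z₃ = h + s' * (z₁ * z₂ * z₃)) :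
    isogonalOuter p q p' q' s' t Z Z' * (z₁ * z₂ * z₃)
      + (isogonalMiddle p q p' q' s s' h t Z Z' + isogonalMiddle q p q' p' s' s t h Z' Z)
      + isogonalOuter q p q' p' s h Z' Z * (z₁ * z₂ * z₃)⁻¹
      + (p * (Z - z₁) + q * (Z' - z₁⁻¹)) *
        (p * q' * (Z ^ 2 - s * Z + h) + p' * q * (Z' ^ 2 - s' * Z' + t)
          + (p * p' + q * q') * (Z * Z' - 1) + p * q' * (s' - t * Z - Z') * (z₁ * z₂ * z₃)
          + p' * q * (s - h * Z' - Z) * (z₁ * z₂ * z₃)⁻¹) =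
    (p' * (z₁⁻¹ - Z') + q' * (z₁ - Z)) * (p - q * (z₁⁻¹ * z₂⁻¹)) * (p - q * (z₁⁻¹ * z₃⁻¹)) *
      (z₁ * (Z + z₂ * z₃ * Z' - z₂ - z₃)) := by
  obtain rfl : s = z₁ + z₂ + z₃ - t * (z₁ * z₂ * z₃) := by linear_combination -hs
  obtain rfl : h = z₁ * z₂ + z₁ * z₃ + z₂ * z₃ - s' * (z₁ * z₂ * z₃) := by linear_combination -hh
  unfold isogonalOuter isogonalMiddle
  field_simp
  ring

/-- Reflection in the line through `A` and `A + v`. -/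
theorem reflection_line_apply (A v X : ℂ) (hv : v ≠ 0)
    [Nonempty (line[ℝ, A, A + v])] :
    reflection (line[ℝ, A, A + v]) X = A + v * conj ((X - A) / v) := by
  set w := (X - A) / v with hw
  have hX : X = (w.im * (v * I)) + (A + w.re * v) := by
    have : X - A = v * w := by rw [hw]; field_simp
    have h2 : (w.re : ℂ) + w.im * I = w := re_add_im w
    linear_combination this - v * h2
  have hmem : A + w.re * v ∈ line[ℝ, A, A + v] := mem_line_iff.2 ⟨w.re, by ring⟩
  have horth : (w.im * (v * I) : ℂ) ∈ (line[ℝ, A, A + v]).directionᗮ := by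
    rw [direction_affineSpan, vectorSpan_pair_rev,
      Submodule.mem_orthogonal_singleton_iff_inner_right]
    simp [Complex.inner]
    ring
  have hr := reflection_orthogonal_vadd hmem horth
  rw [vadd_eq_add, ← hX] at hr
  rw [hr]
  have h3 : conj w = w.re - w.im * I := by apply Complex.ext <;> simp
  rw [h3, vadd_eq_add]; ring

/-- The bisector direction `v` satisfies `v / v̄ = (B - A)(C - A) / (|B - A| |C - A|)`, so the
reflection is `X ↦ A + (v / v̄) conj (X - A)`. The resulting condition says that the arguments of `P
- A` and `Q - A` add up to those of the two sides, modulo `π`. -/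
theorem mem_reflectedCevian_iff {A B C P Q : ℂ} (hP : P ≠ A)
    (hdet : (B - A) * conj (C - A) - conj (B - A) * (C - A) ≠ 0) :
    Q ∈ reflectedCevian A B C P ↔
      ∃ r : ℝ, (P - A) * (Q - A) = r * ((B - A) * (C - A)) := by
  have hB : B - A ≠ 0 := by intro h; simp [h] at hdet
  have hC : C - A ≠ 0 := by intro h; simp [h] at hdet
  have hP' : P - A ≠ 0 := sub_ne_zero.2 hP
  set b : ℂ := (‖B - A‖ : ℂ) with hb
  set c : ℂ := (‖C - A‖ : ℂ) with hc
  have hb0 : b ≠ 0 := by simpa [hb] using hB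
  have hc0 : c ≠ 0 := by simpa [hc] using hC
  have hbb : (B - A) * conj (B - A) = b ^ 2 := by
    rw [mul_conj, normSq_eq_norm_sq, hb]; push_cast; rfl
  have hcc : (C - A) * conj (C - A) = c ^ 2 := by
    rw [mul_conj, normSq_eq_norm_sq, hc]; push_cast; rfl
  have hpp : (P - A) * conj (P - A) = ((normSq (P - A) : ℝ) : ℂ) := mul_conj _
  set v : ℂ := ‖B - A‖⁻¹ • (B - A) + ‖C - A‖⁻¹ • (C - A) with hv
  have hv' : v = (B - A) / b + (C - A) / c := by
    rw [hv, real_smul, real_smul, ofReal_inv, ofReal_inv, ← hb, ← hc]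
    ring
  have hcv : conj v = conj (B - A) / b + conj (C - A) / c := by
    rw [hv', map_add, map_div₀, map_div₀, hb, hc, conj_ofReal, conj_ofReal]
  have hv0 : v ≠ 0 := by
    intro h0
    apply hdet
    have e1 : (B - A) * c = - (C - A) * b := by
      rw [hv'] at h0; field_simp at h0; linear_combination h0
    have e2 : conj (B - A) * c = - conj (C - A) * b := by
      have := hcv; rw [h0, map_zero] at this; field_simp at this; linear_combination -this
    apply mul_left_cancel₀ hc0
    linear_combination conj (C - A) * e1 - (C - A) * e2
  have hcv0 : conj v ≠ 0 := (map_ne_zero _).2 hv0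
  have hmul : (B - A) * (C - A) * conj v = b * c * v := by
    rw [hcv, hv']; field_simp
    linear_combination (C - A) * c * hbb + (B - A) * b * hcc
  have hrefl : ∀ X, reflection (angleBisector A B C) X
      = A + (B - A) * (C - A) / (b * c) * conj (X - A) := by
    intro X
    have : reflection (angleBisector A B C) X = A + v * conj ((X - A) / v) :=
      reflection_line_apply A v X hv0
    rw [this, map_div₀, mul_div_assoc', add_right_inj]
    field_simp
    linear_combination -conj (X - A) * hmul
  have hn0 : ((normSq (P - A) : ℝ) : ℂ) ≠ 0 := by
    rw [← hpp]; exact mul_ne_zero hP' ((map_ne_zero _).2 hP')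
  constructor
  · rintro ⟨X, hX, rfl⟩
    obtain ⟨r, rfl⟩ := mem_line_iff.1 hX
    refine ⟨r * normSq (P - A) / (‖B - A‖ * ‖C - A‖), ?_⟩
    rw [hrefl]
    push_cast
    rw [← hpp, ← hb, ← hc, add_sub_cancel_left, add_sub_cancel_left, map_mul, conj_ofReal]
    ring
  · rintro ⟨r, hr⟩
    refine ⟨A + ((r * (‖B - A‖ * ‖C - A‖) / normSq (P - A) : ℝ) : ℂ) * (P - A),
      mem_line_iff.2 ⟨_, rfl⟩, ?_⟩
    rw [hrefl, add_sub_cancel_left, map_mul, conj_ofReal]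
    push_cast
    rw [← hb, ← hc]
    apply mul_left_cancel₀ hP'
    have : (P - A) * ((B - A) * (C - A) / (b * c) *
        (r * (b * c) / ((normSq (P - A) : ℝ) : ℂ) * conj (P - A))) = r * ((B - A) * (C - A)) := by
      field_simp
      linear_combination r * hpp
    linear_combination this - hr

/-- The numerator of the isogonal conjugate of the image of `Z`, relative to that image, with
respect to the Poncelet triangle with parameter `l`; the denominator is `power`. -/
def isogonalNum (p q s h l Z : ℂ) : ℂ :=
  isogonalOuter p q (conj p) (conj q) (conj s) (conj h) Z (conj Z) * l
    + (isogonalMiddle p q (conj p) (conj q) s (conj s) h (conj h) Z (conj Z)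
      + isogonalMiddle q p (conj q) (conj p) (conj s) s (conj h) h (conj Z) Z)
    + isogonalOuter q p (conj q) (conj p) s h (conj Z) Z * conj l

theorem sub_eq_of_unit {p q x y : ℂ} (hx : x * conj x = 1) (hy : y * conj y = 1) :
    (p * x + q * conj x) - (p * y + q * conj y) = (x - y) * (p - q * (conj x * conj y)) := by
  linear_combination q * conj y * hx - q * conj x * hy

namespace IsBlaschkeTriple

variable {s h z₁ z₂ z₃ : ℂ} (H : IsBlaschkeTriple s h z₁ z₂ z₃)
include H

theorem isogonalNum_add (p q Z : ℂ) :
    isogonalNum p q s h (z₁ * z₂ * z₃) Z + ((p * Z + q * conj Z) - (p * z₁ + q * conj z₁)) *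
      (power p q s h (z₁ * z₂ * z₃) Z : ℂ) =
    conj ((p * z₁ + q * conj z₁) - (p * Z + q * conj Z)) *
      ((p - q * (conj z₁ * conj z₂)) * (p - q * (conj z₁ * conj z₃))) *
      (z₁ * (Z + z₂ * z₃ * conj Z - z₂ - z₃)) := by
  have n₁ := left_ne_zero_of_mul_eq_one H.unit₁
  have n₂ := left_ne_zero_of_mul_eq_one H.unit₂
  have n₃ := left_ne_zero_of_mul_eq_one H.unit₃
  have key := isogonal_identity (p := p) (q := q) (p' := conj p) (q' := conj q) (Z := Z)
    (Z' := conj Z) n₁ n₂ n₃ H.sum H.sum_mul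
  rw [ofReal_power, ofReal_powerConst, powerCoeff, isogonalNum, conj_eq_of_mul_conj H.unit_mul,
    conj_eq_of_mul_conj H.unit₂, conj_eq_of_mul_conj H.unit₃]
  have e1 : conj ((p * z₁ + q * conj z₁) - (p * Z + q * conj Z)) =
      conj p * (z₁⁻¹ - conj Z) + conj q * (z₁ - Z) := by
    simp only [map_add, map_sub, map_mul, conj_conj]
    rw [conj_eq_of_mul_conj H.unit₁]; ring
  rw [e1, conj_eq_of_mul_conj H.unit₁]
  simp only [map_sub, map_mul, conj_conj]
  linear_combination key

/-- Barycentric coordinates are real. -/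
theorem exists_barycentric (Z : ℂ) : ∃ β : ℝ,
    z₁ * (Z + z₂ * z₃ * conj Z - z₂ - z₃) = β * ((z₁ - z₂) * (z₁ - z₃)) := by
  have d₁₂ := sub_ne_zero.2 H.ne₁₂
  have d₁₃ := sub_ne_zero.2 H.ne₁₃
  have n₁ := left_ne_zero_of_mul_eq_one H.unit₁
  have n₂ := left_ne_zero_of_mul_eq_one H.unit₂
  have n₃ := left_ne_zero_of_mul_eq_one H.unit₃
  have hD := mul_ne_zero d₁₂ d₁₃
  have hreal : conj (z₁ * (Z + z₂ * z₃ * conj Z - z₂ - z₃) / ((z₁ - z₂) * (z₁ - z₃))) =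
      z₁ * (Z + z₂ * z₃ * conj Z - z₂ - z₃) / ((z₁ - z₂) * (z₁ - z₃)) := by
    have c₁₂ : z₁⁻¹ - z₂⁻¹ ≠ 0 := sub_ne_zero.2 fun e => H.ne₁₂ (inv_injective e)
    have c₁₃ : z₁⁻¹ - z₃⁻¹ ≠ 0 := sub_ne_zero.2 fun e => H.ne₁₃ (inv_injective e)
    simp only [map_div₀, map_add, map_sub, map_mul, conj_conj]
    rw [conj_eq_of_mul_conj H.unit₁, conj_eq_of_mul_conj H.unit₂, conj_eq_of_mul_conj H.unit₃,
      div_eq_div_iff (mul_ne_zero c₁₂ c₁₃) hD]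
    field_simp
    ring
  obtain ⟨β, hβ⟩ := conj_eq_iff_real.1 hreal
  refine ⟨β, ?_⟩
  rw [← hβ, div_mul_cancel₀ _ hD]

theorem det_ne_zero {p q : ℂ} (hpq : p * conj p - q * conj q ≠ 0) :
    ((p * z₂ + q * conj z₂) - (p * z₁ + q * conj z₁)) *
      conj ((p * z₃ + q * conj z₃) - (p * z₁ + q * conj z₁)) -
      conj ((p * z₂ + q * conj z₂) - (p * z₁ + q * conj z₁)) *
      ((p * z₃ + q * conj z₃) - (p * z₁ + q * conj z₁)) ≠ 0 := by
  have n₁ := left_ne_zero_of_mul_eq_one H.unit₁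
  have n₂ := left_ne_zero_of_mul_eq_one H.unit₂
  have n₃ := left_ne_zero_of_mul_eq_one H.unit₃
  have d₁₂ := sub_ne_zero.2 H.ne₁₂
  have d₁₃ := sub_ne_zero.2 H.ne₁₃
  have d₂₃ := sub_ne_zero.2 H.ne₂₃
  intro h0
  simp only [map_add, map_sub, map_mul, conj_conj] at h0
  rw [conj_eq_of_mul_conj H.unit₁, conj_eq_of_mul_conj H.unit₂, conj_eq_of_mul_conj H.unit₃] at h0
  have key : (p * conj p - q * conj q) * ((z₁ - z₂) * (z₁ - z₃) * (z₂ - z₃)) = 0 := by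
    field_simp at h0
    apply mul_left_cancel₀ n₁
    linear_combination -h0
  simp only [mul_eq_zero] at key
  tauto

variable {φ : ℂ ≃ᵃ[ℝ] ℂ} {a p q : ℂ}

theorem exists_vertex_identity (hφ : ∀ z, φ z = a + p * z + q * conj z) (Z : ℂ) :
    ∃ β : ℝ, z₁ * (Z + z₂ * z₃ * conj Z - z₂ - z₃) = β * ((z₁ - z₂) * (z₁ - z₃)) ∧
      isogonalNum p q s h (z₁ * z₂ * z₃) Z +
        (φ Z - φ z₁) * (power p q s h (z₁ * z₂ * z₃) Z : ℂ) =
      conj (φ z₁ - φ Z) * (β * ((φ z₂ - φ z₁) * (φ z₃ - φ z₁))) := by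
  obtain ⟨β, hβ⟩ := H.exists_barycentric Z
  refine ⟨β, hβ, ?_⟩
  have hsub : ∀ x y, φ x - φ y = (p * x + q * conj x) - (p * y + q * conj y) := by
    intro x y; rw [hφ, hφ]; ring
  have := H.isogonalNum_add p q Z
  rw [hβ] at this
  rw [hsub, hsub, hsub z₂, hsub z₃, this, sub_eq_of_unit H.unit₂ H.unit₁,
    sub_eq_of_unit H.unit₃ H.unit₁]
  ring

theorem det_apply_ne_zero (hφ : ∀ z, φ z = a + p * z + q * conj z)
    (hpq : p * conj p - q * conj q ≠ 0) :
    (φ z₂ - φ z₁) * conj (φ z₃ - φ z₁) - conj (φ z₂ - φ z₁) * (φ z₃ - φ z₁) ≠ 0 := by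
  have hsub : ∀ x y, φ x - φ y = (p * x + q * conj x) - (p * y + q * conj y) := by
    intro x y; rw [hφ, hφ]; ring
  rw [hsub, hsub]
  exact H.det_ne_zero hpq

theorem mem_reflectedCevian_of_num (hφ : ∀ z, φ z = a + p * z + q * conj z)
    (hpq : p * conj p - q * conj q ≠ 0) {Z Q : ℂ} (hZ : φ Z ≠ φ z₁)
    (hpow : power p q s h (z₁ * z₂ * z₃) Z ≠ 0)
    (hQ : (Q - φ Z) * (power p q s h (z₁ * z₂ * z₃) Z : ℂ) =
      isogonalNum p q s h (z₁ * z₂ * z₃) Z) :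
    Q ∈ reflectedCevian (φ z₁) (φ z₂) (φ z₃) (φ Z) := by
  rw [mem_reflectedCevian_iff hZ (H.det_apply_ne_zero hφ hpq)]
  obtain ⟨β, -, hβ⟩ := H.exists_vertex_identity hφ Z
  set w := power p q s h (z₁ * z₂ * z₃) Z with hw
  have hw0 : (w : ℂ) ≠ 0 := ofReal_ne_zero.2 hpow
  refine ⟨-(normSq (φ Z - φ z₁) * β / w), ?_⟩
  push_cast
  rw [← mul_conj]
  apply mul_left_cancel₀ hw0
  have e : (w : ℂ) * (-((φ Z - φ z₁) * conj (φ Z - φ z₁) * β / w) *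
      ((φ z₂ - φ z₁) * (φ z₃ - φ z₁))) = (φ Z - φ z₁) * (conj (φ z₁ - φ Z) *
        (β * ((φ z₂ - φ z₁) * (φ z₃ - φ z₁)))) := by
    rw [map_sub, map_sub]; field_simp; ring
  rw [e, ← hβ]
  linear_combination (φ Z - φ z₁) * hQ

theorem isIsogonalConjugate_iff (hφ : ∀ z, φ z = a + p * z + q * conj z)
    (hpq : p * conj p - q * conj q ≠ 0) {Z Q : ℂ} (hZ : ‖Z‖ ≠ 1) :
    IsIsogonalConjugate (φ z₁) (φ z₂) (φ z₃) (φ Z) Q ↔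
      power p q s h (z₁ * z₂ * z₃) Z ≠ 0 ∧
      (Q - φ Z) * (power p q s h (z₁ * z₂ * z₃) Z : ℂ) =
        isogonalNum p q s h (z₁ * z₂ * z₃) Z := by
  have hne : ∀ z, z * conj z = 1 → φ Z ≠ φ z := by
    intro z hz e
    rw [φ.injective e] at hZ
    exact hZ (norm_eq_one_iff_mul_conj.2 hz)
  have p2 : z₂ * z₃ * z₁ = z₁ * z₂ * z₃ := by ring
  have p3 : z₃ * z₁ * z₂ = z₁ * z₂ * z₃ := by ring
  constructor
  · intro hI
    obtain ⟨r₁, hr₁⟩ := (mem_reflectedCevian_iff hI.ne_A (H.det_apply_ne_zero hφ hpq)).1 hI.mem_A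
    obtain ⟨r₂, hr₂⟩ := (mem_reflectedCevian_iff hI.ne_B
      (H.rotate.det_apply_ne_zero hφ hpq)).1 hI.mem_B
    obtain ⟨r₃, hr₃⟩ := (mem_reflectedCevian_iff hI.ne_C
      (H.rotate.rotate.det_apply_ne_zero hφ hpq)).1 hI.mem_C
    obtain ⟨β₁, hb₁, hβ₁⟩ := H.exists_vertex_identity hφ Z
    obtain ⟨β₂, hb₂, hβ₂⟩ := H.rotate.exists_vertex_identity hφ Z
    rw [p2] at hβ₂
    set N := isogonalNum p q s h (z₁ * z₂ * z₃) Z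
    set w : ℂ := ((power p q s h (z₁ * z₂ * z₃) Z : ℝ) : ℂ) with hw
    have d₁₂ := sub_ne_zero.2 H.ne₁₂
    have d₁₃ := sub_ne_zero.2 H.ne₁₃
    have d₂₃ := sub_ne_zero.2 H.ne₂₃
    have norm : ∀ {z X Y : ℂ} {r : ℝ}, φ Z ≠ φ z →
        (φ Z - φ z) * (Q - φ z) = r * (X * Y) →
        ∃ ρ : ℝ, Q - φ z = ρ * conj (φ Z - φ z) * (X * Y) := by
      intro z X Y r hz hr
      have hz' := sub_ne_zero.2 hz
      have hz'' : conj (φ Z - φ z) ≠ 0 := (map_ne_zero _).2 hz'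
      refine ⟨r / normSq (φ Z - φ z), ?_⟩
      push_cast
      rw [← mul_conj]
      apply mul_left_cancel₀ hz'
      rw [hr]
      field_simp
    obtain ⟨ρ₁, k₁⟩ := norm hI.ne_A hr₁
    obtain ⟨ρ₂, k₂⟩ := norm hI.ne_B hr₂
    obtain ⟨ρ₃, k₃⟩ := norm hI.ne_C hr₃
    have v₁₂ : φ z₁ - φ z₂ ≠ 0 := sub_ne_zero.2 fun e => H.ne₁₂ (φ.injective e)
    have v₁₃ : φ z₁ - φ z₃ ≠ 0 := sub_ne_zero.2 fun e => H.ne₁₃ (φ.injective e)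
    have v₂₃ : φ z₂ - φ z₃ ≠ 0 := sub_ne_zero.2 fun e => H.ne₂₃ (φ.injective e)
    -- The second divided difference of the linear function `X ↦ Q - X` at the three vertices
    -- vanishes.
    have E : ρ₁ * conj (φ Z - φ z₁) + ρ₂ * conj (φ Z - φ z₂) + ρ₃ * conj (φ Z - φ z₃) = 0 := by
      apply mul_left_cancel₀ (mul_ne_zero (mul_ne_zero v₁₂ v₁₃) v₂₃)
      linear_combination -(φ z₂ - φ z₃) * k₁ + (φ z₁ - φ z₃) * k₂ - (φ z₁ - φ z₂) * k₃
    have E' : ρ₁ * (φ Z - φ z₁) + ρ₂ * (φ Z - φ z₂) + ρ₃ * (φ Z - φ z₃) = 0 := by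
      have := congrArg conj E
      simpa only [map_add, map_mul, conj_conj, conj_ofReal, map_zero] using this
    have F : ρ₁ * (Z - z₁) + ρ₂ * (Z - z₂) + ρ₃ * (Z - z₃) = 0 := by
      apply mul_left_cancel₀ hpq
      simp only [hφ, map_add, map_sub, map_mul, conj_conj] at E E'
      linear_combination conj p * E' - q * E
    have F' : ρ₁ * (conj Z - conj z₁) + ρ₂ * (conj Z - conj z₂) + ρ₃ * (conj Z - conj z₃) = 0 := by
      have := congrArg conj F
      simpa only [map_add, map_sub, map_mul, conj_ofReal, map_zero] using this
    -- The real weights `ρᵢ` balance the vectors from the vertices to the point, so they are `κ`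
    -- times its barycentric coordinates. The vertex identities then give `-κ w = 1`, hence a
    -- nonzero power.
    set κ : ℂ := ρ₁ + ρ₂ + ρ₃ with hκ
    have g₁ : (ρ₁ : ℂ) = κ * β₁ := by
      apply mul_left_cancel₀ (mul_ne_zero d₁₂ d₁₃)
      linear_combination κ * hb₁ - z₁ * F - z₁ * z₂ * z₃ * F' - ρ₁ * z₂ * z₃ * H.unit₁
        - ρ₂ * z₁ * z₃ * H.unit₂ - ρ₃ * z₁ * z₂ * H.unit₃
    have g₂ : (ρ₂ : ℂ) = κ * β₂ := by
      apply mul_left_cancel₀ (mul_ne_zero d₁₂ d₂₃)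
      linear_combination -κ * hb₂ + z₂ * F + z₁ * z₂ * z₃ * F' + ρ₁ * z₂ * z₃ * H.unit₁
        + ρ₂ * z₁ * z₃ * H.unit₂ + ρ₃ * z₁ * z₂ * H.unit₃
    have l₁ : Q - φ z₁ = -κ * (N + (φ Z - φ z₁) * w) := by
      rw [hβ₁, k₁, g₁, map_sub, map_sub]; ring
    have l₂ : Q - φ z₂ = -κ * (N + (φ Z - φ z₂) * w) := by
      rw [hβ₂, k₂, g₂, map_sub, map_sub]; ring
    have hκw : -κ * w = 1 := by
      apply mul_left_cancel₀ v₁₂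
      linear_combination l₁ - l₂
    have hw0 : w ≠ 0 := right_ne_zero_of_mul_eq_one hκw
    refine ⟨by rwa [hw, ofReal_ne_zero] at hw0, ?_⟩
    linear_combination w * l₁ + (N + (φ Z - φ z₁) * w) * hκw
  · rintro ⟨hpow, hQ⟩
    refine ⟨hne _ H.unit₁, hne _ H.unit₂, hne _ H.unit₃,
      H.mem_reflectedCevian_of_num hφ hpq (hne _ H.unit₁) hpow hQ,
      H.rotate.mem_reflectedCevian_of_num hφ hpq (hne _ H.unit₂) ?_ ?_,
      H.rotate.rotate.mem_reflectedCevian_of_num hφ hpq (hne _ H.unit₃) ?_ ?_⟩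
    · rwa [p2]
    · rwa [p2]
    · rwa [p3]
    · rwa [p3]

end IsBlaschkeTriple

/-! ### The focal form and nondegeneracy of the locus -/

/-- The polynomial with zeros at the foci of the inner ellipse. -/
def focalForm (p q s s' h t Z Z' : ℂ) : ℂ :=
  p ^ 2 * (Z ^ 2 - s * Z + h) + p * q * (2 * Z * Z' - s' * Z - s * Z' + s * s' - h * t - 1)
    + q ^ 2 * (Z' ^ 2 - s' * Z' + t)

/-- Nondegeneracy of the locus: its coordinate determinant factors. -/
theorem isogonal_det (p q p' q' s s' h t Z Z' : ℂ) :
    let n₁ := isogonalOuter p q p' q' s' t Z Z'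
    let n₀ := isogonalMiddle p q p' q' s s' h t Z Z' + isogonalMiddle q p q' p' s' s t h Z' Z
    let n₂ := isogonalOuter q p q' p' s h Z' Z
    let m₂ := isogonalOuter p' q' p q s h Z' Z
    let m₀ := isogonalMiddle p' q' p q s' s t h Z' Z + isogonalMiddle q' p' q p s s' h t Z Z'
    let m₁ := isogonalOuter q' p' q p s' t Z Z'
    let l := p * q' * (s' - t * Z - Z')
    let l' := p' * q * (s - h * Z' - Z)
    let k := p * q' * (Z ^ 2 - s * Z + h) + p' * q * (Z' ^ 2 - s' * Z' + t)
          + (p * p' + q * q') * (Z * Z' - 1)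
    n₁ * (m₀ * l' - m₂ * k) - n₀ * (m₁ * l' - m₂ * l) + n₂ * (m₁ * k - m₀ * l) =
      -(p * p' - q * q') * (p * p' + q * q' - h * p * q' - t * q * p') * (Z * Z' - 1) *
        focalForm p q s s' h t Z Z' * focalForm p' q' s' s t h Z' Z := by
  simp only [isogonalOuter, isogonalMiddle, focalForm]
  ring

/-- At a focus the conjugate is constantly the other focus: the numerator is the power times `p s +
q s' - 2 (p Z + q Z')`, which is twice the vector from the point to the centre of the inner ellipse.
-/
theorem isogonal_of_focalForm_eq_zero {p q p' q' s s' h t Z Z' : ℂ}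
    (hS : p * p' + q * q' ≠ 0) (hδ : p * p' - q * q' ≠ 0)
    (hf : focalForm p q s s' h t Z Z' = 0) (hf' : focalForm p' q' s' s t h Z' Z = 0) :
    isogonalOuter p q p' q' s' t Z Z' =
      (p * s + q * s' - 2 * (p * Z + q * Z')) * (p * q' * (s' - t * Z - Z')) ∧
    isogonalMiddle p q p' q' s s' h t Z Z' + isogonalMiddle q p q' p' s' s t h Z' Z =
      (p * s + q * s' - 2 * (p * Z + q * Z')) *
        (p * q' * (Z ^ 2 - s * Z + h) + p' * q * (Z' ^ 2 - s' * Z' + t)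
          + (p * p' + q * q') * (Z * Z' - 1)) := by
  unfold focalForm at hf hf'
  have hA : (p * p' + q * q') * (Z ^ 2 - s * Z + h) =
      -(q * p') * (2 * Z * Z' - s' * Z - s * Z' + s * s' - h * t - 1) := by
    apply mul_left_cancel₀ hδ
    linear_combination p' ^ 2 * hf - q ^ 2 * hf'
  have hB : (p * p' + q * q') * (Z' ^ 2 - s' * Z' + t) =
      -(p * q') * (2 * Z * Z' - s' * Z - s * Z' + s * s' - h * t - 1) := by
    apply mul_left_cancel₀ hδ
    linear_combination p ^ 2 * hf' - q' ^ 2 * hf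
  constructor
  · apply mul_left_cancel₀ hS
    unfold isogonalOuter
    linear_combination -(p ^ 2 * q' * t) * hA + (-p ^ 2 * p' + p * p' * q * t - p * q * q') * hB
  · apply mul_left_cancel₀ hS
    unfold isogonalMiddle
    linear_combination (p ^ 2 * q' * (Z - s) + p ^ 2 * p' * Z' + p * q * q' * s') * hA +
      (q ^ 2 * q' * Z + p' * q ^ 2 * (Z' - s') + p * q * p' * s) * hB

/-- The sum of the squares of the semiaxes dominates the focal term. -/
theorem axes_pos {p q h : ℂ} (hpq : p * conj p - q * conj q ≠ 0) (hh : ‖h‖ < 1) :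
    p * conj p + q * conj q - h * p * conj q - conj h * q * conj p ≠ 0 := by
  have e : p * conj p + q * conj q - h * p * conj q - conj h * q * conj p =
      ((‖p‖ ^ 2 + ‖q‖ ^ 2 - 2 * (h * p * conj q).re : ℝ) : ℂ) := by
    have : ((2 * (h * p * conj q).re : ℝ) : ℂ) = h * p * conj q + conj (h * p * conj q) := by
      rw [add_conj]
    rw [ofReal_sub, this, ofReal_add, ← normSq_eq_norm_sq, ← normSq_eq_norm_sq, ← mul_conj,
      ← mul_conj]
    simp only [map_mul, conj_conj]
    ring
  rw [e, ofReal_ne_zero]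
  have hne : ‖p‖ ≠ ‖q‖ := by
    intro h0
    apply hpq
    rw [mul_conj, mul_conj, normSq_eq_norm_sq, normSq_eq_norm_sq, h0, sub_self]
  have h1 : (h * p * conj q).re ≤ ‖h‖ * (‖p‖ * ‖q‖) := by
    refine (re_le_norm _).trans ?_
    rw [norm_mul, norm_mul, norm_conj, mul_assoc]
  have h2 : 0 < (‖p‖ - ‖q‖) ^ 2 := by
    have := sub_ne_zero.2 hne
    positivity
  have h3 : 0 ≤ ‖p‖ * ‖q‖ := by positivity
  nlinarith

theorem axes_sum_ne_zero {p q : ℂ} (hpq : p * conj p - q * conj q ≠ 0) :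
    p * conj p + q * conj q ≠ 0 := by
  simpa using axes_pos (h := 0) hpq (by simp)

/-- If `p q̄ = 0`, the power is a nonzero multiple of `|Z|² - 1`. Otherwise a zero varying part
gives `Z = s - h Z̄`, and substitution turns the constant part into `|Z|² - 1` times the factor of
`axes_pos`. -/
theorem norm_eq_one_of_power_eq_zero {p q s h Z : ℂ} (hpq : p * conj p - q * conj q ≠ 0)
    (hh : ‖h‖ < 1) (hk : powerConst p q s h Z = 0) (hl : powerCoeff p q s h Z = 0) : ‖Z‖ = 1 := by
  rw [norm_eq_one_iff_mul_conj]
  rw [← ofReal_eq_zero, ofReal_powerConst] at hk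
  have hl' := congrArg conj hl
  simp only [powerCoeff, map_mul, map_sub, conj_conj, map_zero] at hl hl'
  by_cases h0 : p * conj q = 0
  · have h0' : conj p * q = 0 := by
      have := congrArg conj h0
      simpa only [map_mul, conj_conj, map_zero] using this
    rw [h0, h0'] at hk
    have := (mul_eq_zero.1 (by linear_combination hk :
      (p * conj p + q * conj q) * (Z * conj Z - 1) = 0)).resolve_left (axes_sum_ne_zero hpq)
    linear_combination this
  · have e1 := (mul_eq_zero.1 hl).resolve_left h0
    have e2 : s - h * conj Z - Z = 0 := by
      have := congrArg conj e1
      simpa only [map_mul, map_sub, conj_conj, map_zero] using this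
    have e3 : (p * conj p + q * conj q - h * p * conj q - conj h * q * conj p) *
        (Z * conj Z - 1) = 0 := by
      linear_combination hk + p * conj q * Z * e2 + conj p * q * conj Z * e1
    have := (mul_eq_zero.1 e3).resolve_left (axes_pos hpq hh)
    linear_combination this

/-- The numerator of the isogonal conjugate does not vanish on the circumcircle. -/
theorem IsBlaschkeTriple.isogonalNum_ne_zero {s h z₁ z₂ z₃ : ℂ}
    (H : IsBlaschkeTriple s h z₁ z₂ z₃) {φ : ℂ ≃ᵃ[ℝ] ℂ} {a p q : ℂ}
    (hφ : ∀ z, φ z = a + p * z + q * conj z) {Z : ℂ} (hZ : ‖Z‖ ≠ 1)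
    (hpow : power p q s h (z₁ * z₂ * z₃) Z = 0) :
    isogonalNum p q s h (z₁ * z₂ * z₃) Z ≠ 0 := by
  intro hN
  -- If numerator and power both vanish, the vertex identity makes every barycentric coordinate of
  -- `Z` zero; two of them already force `|Z| = 1`.
  have key : ∀ {x y w : ℂ}, IsBlaschkeTriple s h x y w → x * y * w = z₁ * z₂ * z₃ →
      Z + y * w * conj Z - y - w = 0 := by
    intro x y w K hK
    obtain ⟨β, hβ, hβ'⟩ := K.exists_vertex_identity hφ Z
    rw [hK, hN, hpow, ofReal_zero, mul_zero, add_zero] at hβ'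
    have v₁ : φ y - φ x ≠ 0 := sub_ne_zero.2 fun e => K.ne₁₂ (φ.injective e).symm
    have v₂ : φ w - φ x ≠ 0 := sub_ne_zero.2 fun e => K.ne₁₃ (φ.injective e).symm
    have v₃ : conj (φ x - φ Z) ≠ 0 := by
      rw [map_ne_zero, sub_ne_zero]
      intro e
      rw [← φ.injective e] at hZ
      exact hZ (norm_eq_one_iff_mul_conj.2 K.unit₁)
    have hb : (β : ℂ) = 0 := (mul_eq_zero.1 ((mul_eq_zero.1 hβ'.symm).resolve_left
      v₃)).resolve_right (mul_ne_zero v₁ v₂)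
    rw [hb, zero_mul] at hβ
    exact (mul_eq_zero.1 hβ).resolve_left (left_ne_zero_of_mul_eq_one K.unit₁)
  have k₁ := key H rfl
  have k₂ := key H.rotate (by ring)
  have k₃ : z₃ * conj Z = 1 := by
    apply mul_left_cancel₀ (sub_ne_zero.2 H.ne₁₂)
    linear_combination k₂ - k₁
  apply hZ
  have hn := congrArg norm k₃
  rwa [norm_mul, norm_eq_one_iff_mul_conj.2 H.unit₃, norm_conj, one_mul, norm_one] at hn

/-! ### Quadratic curves are parabolas -/

/-- The range of a quadratic curve `x ↦ a + x y i c + x² c` is a parabola. -/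
theorem isParabola_range_orthogonal (a c : ℂ) (y : ℝ) (hc : c ≠ 0) (hy : y ≠ 0) :
    IsParabola (Set.range fun x : ℝ => a + x * (y * I * c) + x ^ 2 * c) := by
  have hc0 : 0 < ‖c‖ := norm_pos_iff.2 hc
  have coord : ∀ X : ℂ, ∃ U V : ℝ, X = a + (⟨U, V⟩ : ℂ) * c := by
    intro X
    exact ⟨((X - a) / c).re, ((X - a) / c).im, by
      rw [show (⟨((X - a) / c).re, ((X - a) / c).im⟩ : ℂ) = (X - a) / c from rfl,
        div_mul_cancel₀ _ hc]; ring⟩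
  have hdist : ∀ u v : ℂ, dist (a + u * c) (a + v * c) = ‖u - v‖ * ‖c‖ := by
    intro u v
    rw [dist_eq, ← norm_mul]; congr 1; ring
  -- In coordinates `X = a + (U + i V) c` the curve is `V² = y² U`, with focus `(y²/4, 0)` and
  -- directrix `U = -y²/4`.
  set f : ℝ := y ^ 2 / 4 with hf
  have hf0 : 0 < f := by positivity
  set D₁ : ℂ := a + (⟨-f, 0⟩ : ℂ) * c with hD₁
  set D₂ : ℂ := a + (⟨-f, 1⟩ : ℂ) * c with hD₂
  have hline : ∀ X, X ∈ line[ℝ, D₁, D₂] ↔ ∃ v : ℝ, X = a + (⟨-f, v⟩ : ℂ) * c := by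
    intro X
    rw [mem_line_iff]
    refine exists_congr fun v => ?_
    have : D₁ + v * (D₂ - D₁) = a + (⟨-f, v⟩ : ℂ) * c := by
      have e : (⟨-f, v⟩ : ℂ) = ⟨-f, 0⟩ + v * (⟨-f, 1⟩ - ⟨-f, 0⟩) := by
        apply Complex.ext <;> simp
      rw [hD₁, hD₂, e]; ring
    rw [this]
  have hinj : ∀ u v : ℂ, a + u * c = a + v * c → u = v := fun u v h =>
    mul_right_cancel₀ hc (add_left_cancel h)
  have hinf : ∀ U V : ℝ, Metric.infDist (a + (⟨U, V⟩ : ℂ) * c) (line[ℝ, D₁, D₂] : Set ℂ)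
      = |U + f| * ‖c‖ := by
    intro U V
    apply le_antisymm
    · refine (Metric.infDist_le_dist_of_mem ((hline _).2 ⟨V, rfl⟩)).trans_eq ?_
      rw [hdist]
      congr 1
      have : (⟨U, V⟩ : ℂ) - ⟨-f, V⟩ = ((U + f : ℝ) : ℂ) := by
        apply Complex.ext <;> simp
      rw [this, norm_real, Real.norm_eq_abs]
    · rw [Metric.le_infDist ⟨D₁, left_mem_affineSpan_pair ℝ _ _⟩]
      intro X hX
      obtain ⟨v, rfl⟩ := (hline X).1 hX
      rw [hdist]
      refine mul_le_mul_of_nonneg_right ?_ hc0.le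
      have := abs_re_le_norm ((⟨U, V⟩ : ℂ) - ⟨-f, v⟩)
      simpa using this
  have hpt : ∀ x : ℝ, (⟨x ^ 2, x * y⟩ : ℂ) = x ^ 2 + x * (y * I) := by
    intro x
    apply Complex.ext <;> simp [← ofReal_pow]
  refine ⟨a + (⟨f, 0⟩ : ℂ) * c, D₁, D₂, ?_, ?_, ?_⟩
  · intro h
    have := congrArg im (hinj _ _ h)
    simp at this
  · intro h
    obtain ⟨v, hv⟩ := (hline _).1 h
    have := congrArg re (hinj _ _ hv)
    simp only at this
    linarith
  · ext X
    obtain ⟨U, V, rfl⟩ := coord X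
    rw [Set.mem_ofPred_eq, hdist, hinf, mul_left_inj' hc0.ne']
    have h1 : ‖(⟨U, V⟩ : ℂ) - ⟨f, 0⟩‖ = |U + f| ↔ V ^ 2 = y ^ 2 * U := by
      rw [← pow_left_inj₀ (norm_nonneg _) (abs_nonneg _) two_ne_zero, sq_abs,
        ← normSq_eq_norm_sq, normSq_apply]
      simp only [sub_re, sub_im, sub_zero]
      constructor
      · intro h; rw [hf] at h; linarith
      · intro h; rw [hf]; linarith
    rw [h1]
    constructor
    · rintro ⟨x, hx⟩
      have e : (⟨U, V⟩ : ℂ) = ⟨x ^ 2, x * y⟩ := by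
        apply hinj
        rw [← hx]
        rw [hpt]; ring
      have hU : U = x ^ 2 := congrArg re e
      have hV : V = x * y := congrArg im e
      rw [hU, hV]; ring
    · intro h
      refine ⟨V / y, ?_⟩
      have hU : U = (V / y) ^ 2 := by field_simp; linarith
      have hV : V = V / y * y := by field_simp
      have e : (⟨U, V⟩ : ℂ) = ⟨(V / y) ^ 2, V / y * y⟩ := Complex.ext hU hV
      rw [e, hpt]; ring

/-- The range of a quadratic curve with independent coefficients is a parabola. -/
theorem isParabola_range (a b c : ℂ) (hbc : (conj c * b).im ≠ 0) :
    IsParabola (Set.range fun x : ℝ => a + x * b + x ^ 2 * c) := by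
  have hc : c ≠ 0 := by rintro rfl; simp at hbc
  have hb : b = (b / c) * c := (div_mul_cancel₀ _ hc).symm
  set m := (b / c).re with hm
  set y := (b / c).im with hy
  have hb' : b = (m + y * I) * c := by rw [hm, hy, re_add_im]; exact hb
  have hy0 : y ≠ 0 := by
    intro h0
    apply hbc
    rw [hb', h0, show conj c * ((m + (0 : ℝ) * I) * c) = ((m * normSq c : ℝ) : ℂ) by
      push_cast; rw [← mul_conj]; ring, ofReal_im]
  -- The shift of the parameter by `m / 2` removes the component of `b` along `c`.
  convert isParabola_range_orthogonal (a - (m / 2) ^ 2 * c - (m / 2) * (y * I * c)) c y hc hy0 using 1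
  ext X
  constructor
  · rintro ⟨x, rfl⟩
    refine ⟨x + m / 2, ?_⟩
    rw [hb']; push_cast; ring
  · rintro ⟨x, rfl⟩
    refine ⟨x - m / 2, ?_⟩
    rw [hb']; push_cast; ring

theorem conj_isogonalOuter (p q p' q' s' t Z Z' : ℂ) :
    conj (isogonalOuter p q p' q' s' t Z Z') =
      isogonalOuter (conj p) (conj q) (conj p') (conj q') (conj s') (conj t) (conj Z) (conj Z') := by
  simp only [isogonalOuter, map_add, map_sub, map_neg, map_mul, map_pow, map_one, conj_ofNat]

theorem conj_isogonalMiddle (p q p' q' s s' h t Z Z' : ℂ) :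
    conj (isogonalMiddle p q p' q' s s' h t Z Z') =
      isogonalMiddle (conj p) (conj q) (conj p') (conj q') (conj s) (conj s') (conj h) (conj t)
        (conj Z) (conj Z') := by
  simp only [isogonalMiddle, map_add, map_sub, map_neg, map_mul, map_pow, conj_ofNat]

/-- A quotient of trigonometric polynomials whose denominator has a double zero on the unit circle
is a quadratic curve in a rational parameter. -/
theorem image_unit_eq_range {n₁ n₀ n₂ L l₀ W : ℂ} {k : ℝ} (hk : k ≠ 0) (hl₀ : ‖l₀‖ = 1)
    (hL : L * l₀ = -(k / 2)) :
    {Q : ℂ | ∃ l : ℂ, ‖l‖ = 1 ∧ k + 2 * (L * l).re ≠ 0 ∧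
      (Q - W) * ((k + 2 * (L * l).re : ℝ) : ℂ) = n₁ * l + n₀ + n₂ * conj l} =
    Set.range fun x : ℝ => (W + (n₀ - n₁ * l₀ - n₂ * conj l₀) / (2 * k))
      + x * (I * (n₁ * l₀ - n₂ * conj l₀) / k) + x ^ 2 * ((n₁ * l₀ + n₀ + n₂ * conj l₀) / (2 * k))
      := by
  have hkc : (k : ℂ) ≠ 0 := ofReal_ne_zero.2 hk
  have hl₀' := norm_eq_one_iff_mul_conj.1 hl₀
  have hl0 : l₀ ≠ 0 := left_ne_zero_of_mul_eq_one hl₀'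
  have hden : ∀ m : ℂ, ((k + 2 * (L * (l₀ * m)).re : ℝ) : ℂ) = k * (1 - (m + conj m) / 2) := by
    intro m
    have h1 : L * (l₀ * m) = ((-(k / 2) : ℝ) : ℂ) * m := by
      push_cast; rw [← hL]; ring
    rw [h1, re_ofReal_mul, add_conj]
    push_cast
    ring
  -- With `m = l / l₀ = (x + i)/(x - i)` the denominator is `k (1 - Re m) = 2 k / (x² + 1)`. The
  -- excluded value `m = 1` corresponds to `x = ∞`.
  have main : ∀ (x : ℝ) (m Q : ℂ), m * (x - I) = x + I → conj m * (x + I) = x - I →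
      ((Q - W) * ((k + 2 * (L * (l₀ * m)).re : ℝ) : ℂ) =
        n₁ * (l₀ * m) + n₀ + n₂ * conj (l₀ * m) ↔
      (W + (n₀ - n₁ * l₀ - n₂ * conj l₀) / (2 * k))
      + x * (I * (n₁ * l₀ - n₂ * conj l₀) / k) + x ^ 2 * ((n₁ * l₀ + n₀ + n₂ * conj l₀) / (2 * k))
      = Q) := by
    intro x m Q hm hm'
    have hx : ((x : ℂ) ^ 2 + 1) ≠ 0 := by exact_mod_cast (by positivity : x ^ 2 + 1 ≠ 0)
    have hI : I * I = -1 := I_mul_I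
    have hm1 : m * (x ^ 2 + 1) = x ^ 2 + 2 * x * I - 1 := by
      linear_combination (x + I) * hm + m * hI + hI
    have hm2 : conj m * (x ^ 2 + 1) = x ^ 2 - 2 * x * I - 1 := by
      linear_combination (x - I) * hm' + conj m * hI + hI
    rw [hden, map_mul]
    have e1 : ((x : ℂ) ^ 2 + 1) * ((Q - W) * (k * (1 - (m + conj m) / 2))) = (Q - W) * (2 * k) := by
      linear_combination -(Q - W) * k / 2 * (hm1 + hm2)
    have e2 : ((x : ℂ) ^ 2 + 1) * (n₁ * (l₀ * m) + n₀ + n₂ * (conj l₀ * conj m)) =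
        (n₀ - n₁ * l₀ - n₂ * conj l₀) + x * (2 * I * (n₁ * l₀ - n₂ * conj l₀))
          + x ^ 2 * (n₁ * l₀ + n₀ + n₂ * conj l₀) := by
      linear_combination n₁ * l₀ * hm1 + n₂ * conj l₀ * hm2
    rw [← mul_right_inj' hx, e1, e2]
    constructor
    · intro h
      apply mul_right_cancel₀ (mul_ne_zero two_ne_zero hkc)
      field_simp
      linear_combination -h
    · rintro rfl
      field_simp
      ring
  ext Q
  constructor
  · rintro ⟨l, hl, hne, hQ⟩
    obtain ⟨m, rfl⟩ : ∃ m, l = l₀ * m := ⟨l / l₀, by field_simp⟩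
    have hmn : ‖m‖ = 1 := by rwa [norm_mul, hl₀, one_mul] at hl
    have hmm := norm_eq_one_iff_mul_conj.1 hmn
    have hm1 : m - 1 ≠ 0 := by
      intro h
      apply hne
      rw [← ofReal_eq_zero, hden, sub_eq_zero.1 h]
      simp
    have hm1' : conj m - 1 ≠ 0 := by
      have := (map_ne_zero (starRingEnd ℂ)).2 hm1
      rwa [map_sub, map_one] at this
    have hreal : conj (I * (m + 1) / (m - 1)) = I * (m + 1) / (m - 1) := by
      simp only [map_div₀, map_mul, map_add, map_sub, map_one, conj_I]
      rw [div_eq_div_iff hm1' hm1]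
      linear_combination -2 * I * hmm
    obtain ⟨x, hx⟩ := conj_eq_iff_real.1 hreal
    have hx' : x * (m - 1) = I * (m + 1) := by rw [← hx, div_mul_cancel₀ _ hm1]
    have hx'' : x * (conj m - 1) = -I * (conj m + 1) := by
      have := congrArg conj hx'
      simpa only [map_mul, map_add, map_sub, map_one, conj_I, conj_ofReal] using this
    exact ⟨x, (main x m Q (by linear_combination hx') (by linear_combination hx'')).1 hQ⟩
  · rintro ⟨x, hx⟩
    have hxI : (x : ℂ) - I ≠ 0 := by
      intro h
      have := congrArg im h
      simp at this
    have hxI' : (x : ℂ) + I ≠ 0 := by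
      intro h
      have := congrArg im h
      simp at this
    set m : ℂ := (x + I) / (x - I) with hm
    have hcm : conj m = (x - I) / (x + I) := by
      rw [hm, map_div₀, map_add, map_sub, conj_I, conj_ofReal, sub_neg_eq_add, ← sub_eq_add_neg]
    have h1 : m * (x - I) = x + I := div_mul_cancel₀ _ hxI
    have h2 : conj m * (x + I) = x - I := by rw [hcm, div_mul_cancel₀ _ hxI']
    have hmn : ‖m‖ = 1 := by
      rw [norm_eq_one_iff_mul_conj, hcm, hm]; field_simp
    refine ⟨l₀ * m, by rw [norm_mul, hl₀, hmn, one_mul], ?_, (main x m Q h1 h2).2 hx⟩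
    rw [← ofReal_ne_zero, hden]
    refine mul_ne_zero hkc ?_
    rw [hcm, hm]
    have : 1 - ((x + I) / (x - I) + (x - I) / (x + I)) / 2 = 2 / ((x + I) * (x - I) : ℂ) := by
      field_simp
      linear_combination -4 * I_mul_I
    rw [this]
    exact div_ne_zero two_ne_zero (mul_ne_zero hxI' hxI)

/-- The quadratic curve of `image_unit_eq_range` is nondegenerate if the coordinate determinant of
the quotient does not vanish. -/
theorem im_ne_zero_of_det_ne_zero {n₁ n₀ n₂ L l₀ : ℂ} {k : ℝ} (hk : k ≠ 0)
    (hl₀ : l₀ * conj l₀ = 1) (hL : L * l₀ = -(k / 2))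
    (hdet : n₁ * (conj n₀ * conj L - conj n₁ * k) - n₀ * (conj n₂ * conj L - conj n₁ * L) +
      n₂ * (conj n₂ * k - conj n₀ * L) ≠ 0) :
    (conj ((n₁ * l₀ + n₀ + n₂ * conj l₀) / (2 * k)) *
      (I * (n₁ * l₀ - n₂ * conj l₀) / k)).im ≠ 0 := by
  have hkc : (k : ℂ) ≠ 0 := ofReal_ne_zero.2 hk
  have hLc : conj L * conj l₀ = -(k / 2) := by
    have := congrArg conj hL
    simpa only [map_mul, map_neg, map_div₀, conj_ofReal, conj_ofNat] using this
  -- Eliminating `L` and `L̄` turns the determinant into a multiple of the left side of `hsum`,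
  -- which vanishes together with the imaginary part.
  have hL' : L = -(k / 2) * conj l₀ := by linear_combination conj l₀ * hL - L * hl₀
  have hLc' : conj L = -(k / 2) * l₀ := by linear_combination l₀ * hLc - conj L * hl₀
  intro him
  apply hdet
  have hT := conj_eq_iff_im.2 him
  simp only [map_mul, map_div₀, map_add, map_sub, conj_conj, conj_ofReal, conj_I,
    conj_ofNat] at hT
  have hsum : (conj n₁ * conj l₀ + conj n₀ + conj n₂ * l₀) * (n₁ * l₀ - n₂ * conj l₀) +
      (n₁ * l₀ + n₀ + n₂ * conj l₀) * (conj n₁ * conj l₀ - conj n₂ * l₀) = 0 := by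
    field_simp at hT
    linear_combination -hT
  rw [hLc', hL']
  linear_combination -(k / 2) * hsum + k * (n₁ * conj n₁ - n₂ * conj n₂) * hl₀

/-! ### The boundary of the swept region and the conclusion -/

/-- The boundary of the swept region is contained in the envelope of the circumcircles. -/
theorem sq_powerConst_eq_of_mem_frontier {φ ψ : ℂ ≃ᵃ[ℝ] ℂ} {a p q s h P : ℂ}
    (hφ : ∀ z, φ z = a + p * z + q * conj z) (hpq : p * conj p - q * conj q ≠ 0)
    (hT : ∀ A B C, IsPonceletTriangle (ellipse φ) (ellipse ψ) A B C ↔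
        ∃ z₁ z₂ z₃, IsBlaschkeTriple s h z₁ z₂ z₃ ∧ φ z₁ = A ∧ φ z₂ = B ∧ φ z₃ = C)
    (hex : ∀ l : ℂ, ‖l‖ = 1 → ∃ z₁ z₂ z₃, IsBlaschkeTriple s h z₁ z₂ z₃ ∧ z₁ * z₂ * z₃ = l)
    (hP : P ∈ frontier (sweptRegion (ellipse φ) (ellipse ψ))) :
    powerConst p q s h (φ.symm P) ^ 2 = 4 * ‖powerCoeff p q s h (φ.symm P)‖ ^ 2 := by
  -- A point is swept exactly when its power vanishes for some unit `l`. This is an inequality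
  -- between continuous functions, so equality holds on the frontier.
  have hset : sweptRegion (ellipse φ) (ellipse ψ) =
      {X | powerConst p q s h (φ.symm X) ^ 2 ≤ 4 * ‖powerCoeff p q s h (φ.symm X)‖ ^ 2} := by
    ext X
    rw [Set.mem_ofPred_eq, ← exists_unit_add_two_re_eq_zero_iff]
    constructor
    · rintro ⟨A, B, C, hABC, hX⟩
      obtain ⟨z₁, z₂, z₃, H, rfl, rfl, rfl⟩ := (hT A B C).1 hABC
      rw [← φ.apply_symm_apply X, H.apply_mem_circumcircle_iff hφ hpq] at hX
      exact ⟨z₁ * z₂ * z₃, H.norm_mul_eq_one, hX⟩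
    · rintro ⟨l, hl, h0⟩
      obtain ⟨z₁, z₂, z₃, H, rfl⟩ := hex l hl
      refine ⟨_, _, _, (hT _ _ _).2 ⟨z₁, z₂, z₃, H, rfl, rfl, rfl⟩, ?_⟩
      rw [← φ.apply_symm_apply X, H.apply_mem_circumcircle_iff hφ hpq]
      exact h0
  have hcont : Continuous φ.symm :=
    φ.symm.toAffineMap.continuous_of_finiteDimensional
  rw [hset] at hP
  refine frontier_le_subset_eq ?_ ?_ hP
  · unfold powerConst
    have : Continuous fun z : ℂ => normSq z := continuous_normSq
    have h2 : Continuous fun X => normSq (φ.symm X) := this.comp hcont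
    have h3 : Continuous fun X => (p * conj q * (φ.symm X ^ 2 - s * φ.symm X + h)).re :=
      continuous_re.comp (by fun_prop)
    fun_prop
  · unfold powerCoeff
    have h3 : Continuous fun X => conj (φ.symm X) := continuous_conj.comp hcont
    fun_prop

/-- The locus of the isogonal conjugate of a boundary point of the swept region off the outer
ellipse is a parabola. -/
theorem isogonalLocus_isParabola {φ ψ : ℂ ≃ᵃ[ℝ] ℂ}
    (hnested : ellipse ψ ⊆ ellipseInterior φ) {P : ℂ}
    (hP : P ∈ frontier (sweptRegion (ellipse φ) (ellipse ψ))) (hPE : P ∉ ellipse φ) :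
    IsParabola (isogonalLocus (ellipse φ) (ellipse ψ) P) := by
  obtain ⟨a, p, q, hφ, hpq⟩ := exists_affineEquiv_eq φ
  have hne : (sweptRegion (ellipse φ) (ellipse ψ)).Nonempty := by
    by_contra h0
    rw [Set.not_nonempty_iff_eq_empty.1 h0, frontier_empty] at hP
    exact hP
  obtain ⟨-, A₀, B₀, C₀, hT₀, -⟩ := hne
  obtain ⟨s, h, hh, hT, hex⟩ := exists_isPonceletTriangle_iff hnested ⟨A₀, B₀, C₀, hT₀⟩
  have hfr := sq_powerConst_eq_of_mem_frontier hφ hpq hT hex hP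
  obtain ⟨Z, rfl⟩ : ∃ Z, φ Z = P := φ.surjective P
  rw [apply_mem_ellipse_iff] at hPE
  rw [φ.symm_apply_apply] at hfr
  set k := powerConst p q s h Z with hk
  set L := powerCoeff p q s h Z with hL
  -- On the envelope `k = 0` would give `L = 0`; the power would then vanish for all `l`, which
  -- happens only on the outer ellipse.
  have hk0 : k ≠ 0 := by
    intro h0
    rw [h0] at hfr
    have hL0 : L = 0 := by
      rw [← norm_eq_zero]
      have : ‖L‖ ^ 2 = 0 := by linarith
      exact pow_eq_zero_iff two_ne_zero |>.1 this
    exact hPE (norm_eq_one_of_power_eq_zero hpq hh h0 hL0)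
  have hL0 : L ≠ 0 := by
    intro h0
    rw [h0, norm_zero] at hfr
    exact hk0 (pow_eq_zero_iff two_ne_zero |>.1 (by linarith))
  set l₀ : ℂ := -(k / 2) / L with hl₀def
  have hLl : L * l₀ = -(k / 2) := mul_div_cancel₀ _ hL0
  have hl₀ : ‖l₀‖ = 1 := by
    have hn : ‖(-(k / 2) : ℂ)‖ = ‖L‖ := by
      rw [← pow_left_inj₀ (norm_nonneg _) (norm_nonneg _) two_ne_zero, norm_neg, norm_div,
        norm_real, Real.norm_eq_abs, div_pow, sq_abs, hfr]
      norm_num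
    rw [hl₀def, norm_div, hn, div_self (norm_ne_zero_iff.2 hL0)]
  set n₁ := isogonalOuter p q (conj p) (conj q) (conj s) (conj h) Z (conj Z) with hn₁
  set n₀ := isogonalMiddle p q (conj p) (conj q) s (conj s) h (conj h) Z (conj Z)
      + isogonalMiddle q p (conj q) (conj p) (conj s) s (conj h) h (conj Z) Z with hn₀
  set n₂ := isogonalOuter q p (conj q) (conj p) s h (conj Z) Z with hn₂
  have hlocus : isogonalLocus (ellipse φ) (ellipse ψ) (φ Z) =
      {Q : ℂ | ∃ l : ℂ, ‖l‖ = 1 ∧ k + 2 * (L * l).re ≠ 0 ∧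
      (Q - φ Z) * ((k + 2 * (L * l).re : ℝ) : ℂ) = n₁ * l + n₀ + n₂ * conj l} := by
    ext Q
    constructor
    · rintro ⟨A, B, C, hABC, hQ⟩
      obtain ⟨z₁, z₂, z₃, H, rfl, rfl, rfl⟩ := (hT A B C).1 hABC
      exact ⟨z₁ * z₂ * z₃, H.norm_mul_eq_one, (H.isIsogonalConjugate_iff hφ hpq hPE).1 hQ⟩
    · rintro ⟨l, hl, hQ⟩
      obtain ⟨z₁, z₂, z₃, H, rfl⟩ := hex l hl
      exact ⟨_, _, _, (hT _ _ _).2 ⟨z₁, z₂, z₃, H, rfl, rfl, rfl⟩,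
        (H.isIsogonalConjugate_iff hφ hpq hPE).2 hQ⟩
  rw [hlocus, image_unit_eq_range hk0 hl₀ hLl]
  apply isParabola_range
  have hl₀c := norm_eq_one_iff_mul_conj.1 hl₀
  have hpow : k + 2 * (L * l₀).re = 0 := by
    have : (L * l₀).re = -(k / 2) := by
      rw [hLl, ← ofReal_ofNat, ← ofReal_div, ← ofReal_neg, ofReal_re]
    rw [this]; ring
  have hLc : conj L * conj l₀ = -(k / 2) := by
    have := congrArg conj hLl
    simpa only [map_mul, map_neg, map_div₀, conj_ofReal, conj_ofNat] using this
  have hkf := ofReal_powerConst p q s h Z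
  rw [← hk] at hkf
  -- At a focus the numerator is a constant multiple of the power, so it would vanish at `l₀` as
  -- well; this cannot happen for the triangle with parameter `l₀`.
  have hfocal : focalForm p q s (conj s) h (conj h) Z (conj Z) ≠ 0 := by
    intro hf
    have hf' : focalForm (conj p) (conj q) (conj s) s (conj h) h (conj Z) Z = 0 := by
      have := congrArg conj hf
      simpa only [focalForm, map_add, map_sub, map_mul, map_pow, map_one, map_zero, conj_conj,
        conj_ofNat] using this
    obtain ⟨z₁, z₂, z₃, H, hl⟩ := hex l₀ hl₀
    have hN := H.isogonalNum_ne_zero hφ hPE (by rw [hl]; exact hpow)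
    apply hN
    obtain ⟨o₁, o₀⟩ := isogonal_of_focalForm_eq_zero (axes_sum_ne_zero hpq) hpq hf hf'
    have hf'' : focalForm q p (conj s) s (conj h) h (conj Z) Z = 0 := by
      rw [← hf]; unfold focalForm; ring
    have hf''' : focalForm (conj q) (conj p) s (conj s) h (conj h) Z (conj Z) = 0 := by
      rw [← hf']; unfold focalForm; ring
    obtain ⟨o₂, -⟩ := isogonal_of_focalForm_eq_zero (p := q) (q := p) (p' := conj q)
      (q' := conj p) (by rw [add_comm]; exact axes_sum_ne_zero hpq)
      (by rw [← neg_sub]; exact neg_ne_zero.2 hpq) hf'' hf'''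
    rw [hl, isogonalNum, o₁, o₀, o₂]
    have hLd : L = p * conj q * (conj s - conj h * Z - conj Z) := rfl
    have hLd' : conj L = conj p * q * (s - h * conj Z - Z) := by
      rw [hLd]; simp only [map_mul, map_sub, conj_conj]
    linear_combination (p * s + q * conj s - 2 * (p * Z + q * conj Z)) *
      (hLl + hLc - hkf - l₀ * hLd - conj l₀ * hLd')
  have hfocal' : focalForm (conj p) (conj q) (conj s) s (conj h) h (conj Z) Z ≠ 0 := by
    intro hf
    apply hfocal
    have := congrArg conj hf
    simpa only [focalForm, map_add, map_sub, map_mul, map_pow, map_one, map_zero, conj_conj,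
      conj_ofNat] using this
  have hZ1 : Z * conj Z - 1 ≠ 0 := fun h0 =>
    hPE (norm_eq_one_iff_mul_conj.2 (sub_eq_zero.1 h0))
  have hdet := isogonal_det p q (conj p) (conj q) s (conj s) h (conj h) Z (conj Z)
  have hne := mul_ne_zero (mul_ne_zero (mul_ne_zero (mul_ne_zero (neg_ne_zero.2 hpq)
    (axes_pos hpq hh)) hZ1) hfocal) hfocal'
  have m₁ : conj n₁ = isogonalOuter (conj p) (conj q) p q s h (conj Z) Z := by
    rw [hn₁, conj_isogonalOuter]; simp only [conj_conj]
  have m₂ : conj n₂ = isogonalOuter (conj q) (conj p) q p (conj s) (conj h) Z (conj Z) := by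
    rw [hn₂, conj_isogonalOuter]; simp only [conj_conj]
  have m₀ : conj n₀ = isogonalMiddle (conj p) (conj q) p q (conj s) s (conj h) h (conj Z) Z
      + isogonalMiddle (conj q) (conj p) q p s (conj s) h (conj h) Z (conj Z) := by
    rw [hn₀, map_add, conj_isogonalMiddle, conj_isogonalMiddle]; simp only [conj_conj]
  have hLd : p * conj q * (conj s - conj h * Z - conj Z) = L := rfl
  have hLd' : conj p * q * (s - h * conj Z - Z) = conj L := by
    rw [← hLd]; simp only [map_mul, map_sub, conj_conj]
  simp only [← hn₁, ← hn₀, ← hn₂, ← m₁, ← m₂, ← m₀, hLd, hLd', ← hkf] at hdet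
  rw [← hdet] at hne
  exact im_ne_zero_of_det_ne_zero hk0 hl₀c hLl hne

end PonceletIsogonal

theorem mainTheorem10 (φ ψ : ℂ ≃ᵃ[ℝ] ℂ)
    (hnested : PonceletIsogonal.ellipse ψ ⊆ PonceletIsogonal.ellipseInterior φ)
    (P : ℂ)
    (hP : P ∈ frontier (PonceletIsogonal.sweptRegion
      (PonceletIsogonal.ellipse φ) (PonceletIsogonal.ellipse ψ)))
    (hPE : P ∉ PonceletIsogonal.ellipse φ) :
    PonceletIsogonal.IsParabola (PonceletIsogonal.isogonalLocus
      (PonceletIsogonal.ellipse φ) (PonceletIsogonal.ellipse ψ) P) :=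
  PonceletIsogonal.isogonalLocus_isParabola hnested hP hPE
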